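/- Let $\mathrm{Gr}(n,d)$ be the set of $d$-dimensional linear subspaces of $\mathbb{R}^n$; a uniformly random $d$-dimensional subspace is one distributed according to the unique probability measure on $\mathrm{Gr}(n,d)$ invariant under the orthogonal group. For a subspace $V$ let $\Pi_V$ be the $n\times n$ matrix of the orthogonal projection onto $V$. A degree-4 SoS SDP solution (for Boolean optimization in $n$ variables) is a real symmetric positive semidefinite matrix $\mathcal{M}$ with rows and columns indexed by the subsets of $[n]$ of size at most $2$, such that $\mathcal{M}[\emptyset,\emptyset]=1$ and $\mathcal{M}[S,T]=\mathcal{M}[S',T']$ whenever $S\Delta T=S'\Delta T'$. Its value for the problem $\frac1n\max_{x\in\{\pm1\}^n}x^{\top}\Pi_V x$ is $\frac1n\sum_{i,j=1}^n(\Pi_V)_{ij}\,\mathcal{M}[\{i\},\{j\}]$. Theorem. There are sequences $\varepsilon_n\to0$ and $\delta_n\to0$ such that for all $n$ and all integers $d$ with $n^{0.99}\le d\le n$, if $V$ is a uniformly random $d$-dimensional subspace of $\mathbb{R}^n$, then with probability at least $1-\delta_n$ there exists a degree-4 SoS SDP solution with value at least $1-\varepsilon_n$ for $\frac1n\max_{x\in\{\pm1\}^n}x^{\top}\Pi_V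 x$. -/

import Mathlib

/-- The Grassmannian `Gr(n, d)`: the `d`-dimensional linear subspaces of Euclidean space `ℝⁿ`. -/
def Gr (n d : ℕ) : Type :=
  {V : Submodule ℝ (EuclideanSpace ℝ (Fin n)) // Module.finrank ℝ V = d}

/-- The matrix, in the standard basis, of the orthogonal projection `Π_V` onto the subspace `V`. -/
noncomputable def projMatrix {n : ℕ} (V : Submodule ℝ (EuclideanSpace ℝ (Fin n))) :
    Matrix (Fin n) (Fin n) ℝ :=
  Matrix.of fun i j => V.starProjection (EuclideanSpace.single j 1) i

/-- The Borel σ-algebra of the Grassmannian, whose topology is the one induced by the embedding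
`V ↦ Π_V` into the space of real `n × n` matrices. -/
noncomputable instance Gr.instMeasurableSpace (n d : ℕ) : MeasurableSpace (Gr n d) :=
  MeasurableSpace.comap (fun (V : Gr n d) (i j : Fin n) => projMatrix V.1 i j) inferInstance

/-- The action of the orthogonal group on the Grassmannian: `V ↦ U V`. -/
noncomputable def Gr.rotate {n d : ℕ} (U : EuclideanSpace ℝ (Fin n) ≃ₗᵢ[ℝ] EuclideanSpace ℝ (Fin n))
    (V : Gr n d) : Gr n d :=
  ⟨V.1.map (U.toLinearEquiv : EuclideanSpace ℝ (Fin n) →ₗ[ℝ] EuclideanSpace ℝ (Fin n)),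
    (LinearEquiv.finrank_map_eq U.toLinearEquiv V.1).trans V.2⟩

/-- `μ` is the law of a uniformly random `d`-dimensional subspace of `ℝⁿ`: the (unique) probability
measure on the Grassmannian that is invariant under the orthogonal group. -/
structure IsUniformSubspaceLaw {n d : ℕ} (μ : MeasureTheory.Measure (Gr n d)) : Prop where
  isProbabilityMeasure : MeasureTheory.IsProbabilityMeasure μ
  invariant : ∀ U : EuclideanSpace ℝ (Fin n) ≃ₗᵢ[ℝ] EuclideanSpace ℝ (Fin n),
    MeasureTheory.MeasurePreserving (Gr.rotate U) μ μ

/-- The subsets of `[n]` of size at most `2`. -/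
abbrev SmallSet (n : ℕ) : Type := {S : Finset (Fin n) // S.card ≤ 2}

/-- The empty set as an index. -/
def SmallSet.empty (n : ℕ) : SmallSet n := ⟨∅, by simp⟩

/-- The singleton `{i}` as an index. -/
def SmallSet.single {n : ℕ} (i : Fin n) : SmallSet n := ⟨{i}, by simp⟩

/-- The feasible set of the degree-4 SoS SDP for Boolean optimization: pseudomoment matrices indexed
by the subsets of `[n]` of size at most `2`. -/
structure IsSoS4 {n : ℕ} (M : Matrix (SmallSet n) (SmallSet n) ℝ) : Prop where
  symm : ∀ S T S' T' : SmallSet n,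
    symmDiff S.1 T.1 = symmDiff S'.1 T'.1 → M S T = M S' T'
  normalized : M (SmallSet.empty n) (SmallSet.empty n) = 1
  posSemidef : M.PosSemidef

/-- The value `⟨A, M⟩ = ∑ A_{ij} M[{i},{j}]` of a pseudomoment matrix `M` for the problem of
maximizing the quadratic form `xᵀ A x` over `x ∈ {±1}ⁿ`. -/
noncomputable def sosValue {n : ℕ} (A : Matrix (Fin n) (Fin n) ℝ)
    (M : Matrix (SmallSet n) (SmallSet n) ℝ) : ℝ :=
  ∑ i, ∑ j, A i j * M (SmallSet.single i) (SmallSet.single j)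

/-
By rotation invariance of Haar measure, a property of `V` that holds whenever `V` contains the
columns of a matrix from `S` is at least as likely for a uniformly random `V` as it is for an
`n × d` Gaussian matrix to lie in `S`. Let `x i` be the rows of the Gaussian matrix, `v i` their
normalizations and `X` the Gram matrix of `v`. The pseudomoments are `ρ * X i j` in degree 2 and, in
degree 4, `ρ ^ 2` times
  `(1 + η) * (X i j * X k l + X i k * X j l + X i l * X j k)`
    `- 2 * ∑ m, X m i * X m j * X m k * X m l`,
where `ρ < 1` is close to 1. As `∑ m, X m i * X m j * X m k * X m l` is dominated by the terms in
which `m` is one of the indices, the correction makes the pseudomoment of index `(i, i, k, l)`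
nearly equal to that of index `(k, l)`, and the slack in `ρ` absorbs the errors of imposing this
equality exactly. Positivity in degree 4 comes from the tensors `v m ⊗ v m - I / d` being nearly
orthonormal, which is a spectral bound on the matrix `⟪v i, v j⟫ ^ 2 - 1 / d`, obtained from the
expected squared Frobenius norm of the off-diagonal part of its square. The value is close to 1
because `v i` is close to `x i / √d`, and the columns of `x` lie in `V`.
-/

section SymmDiff

lemma odd_card_symmDiff {α : Type*} [DecidableEq α] {S T : Finset α} (h : Odd (S.card + T.card)) :
    Odd (symmDiff S T).card := by
  have card_symmDiff : (symmDiff S T).card = (S \ T).card + (T \ S).card :=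
    Finset.card_union_of_disjoint disjoint_sdiff_sdiff
  have := Finset.card_sdiff_add_card_inter S T
  have := Finset.inter_comm T S ▸ Finset.card_sdiff_add_card_inter T S
  grind

lemma symmDiff_singleton_of_ne {α : Type*} [DecidableEq α] {i j : α} (hij : i ≠ j) :
    symmDiff ({i} : Finset α) {j} = {i, j} := by
  ext x; simp only [Finset.mem_symmDiff, Finset.mem_singleton, Finset.mem_insert]; grind

lemma symmDiff_pair_of_disjoint {α : Type*} [DecidableEq α] {i j k l : α} (hik : i ≠ k)
    (hil : i ≠ l) (hjk : j ≠ k) (hjl : j ≠ l) :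
    symmDiff ({i, j} : Finset α) {k, l} = {i, j, k, l} := by
  ext x; simp only [Finset.mem_symmDiff, Finset.mem_insert, Finset.mem_singleton]; grind

lemma symmDiff_pair_of_common {α : Type*} [DecidableEq α] {i j l : α} (hij : i ≠ j)
    (hil : i ≠ l) (hjl : j ≠ l) : symmDiff ({j, i} : Finset α) {l, i} = {j, l} := by
  ext x; simp only [Finset.mem_symmDiff, Finset.mem_insert, Finset.mem_singleton]; grind

end SymmDiff

section QuarticKernel

variable {ι : Type*} [Fintype ι] {X : Matrix ι ι ℝ}

/-- The degree-four pseudomoment of four distinct indices, up to the factor `ρ ^ 2`, as a function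
of two ordered pairs which may now overlap. -/
noncomputable def quarticKernel (X : Matrix ι ι ℝ) (η : ℝ) (p q : ι × ι) : ℝ :=
  (1 + η) * (X p.1 p.2 * X q.1 q.2 + X p.1 q.1 * X p.2 q.2 + X p.1 q.2 * X p.2 q.1)
    - 2 * ∑ m, X p.1 m * X p.2 m * X q.1 m * X q.2 m

lemma quarticKernel_swap_left (η : ℝ) (hX : X.IsSymm) (p q : ι × ι) :
    quarticKernel X η p.swap q = quarticKernel X η p q := by
  simp only [quarticKernel, Prod.fst_swap, Prod.snd_swap, hX.apply p.1 p.2, mul_comm (X p.2 _)]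
  ring

lemma quarticKernel_swap_right (η : ℝ) (hX : X.IsSymm) (p q : ι × ι) :
    quarticKernel X η p q.swap = quarticKernel X η p q := by
  simp only [quarticKernel, Prod.fst_swap, Prod.snd_swap, hX.apply q.1 q.2,
    mul_right_comm _ (X q.2 _)]
  ring

end QuarticKernel

section Pseudomoment

variable {ι : Type*} [DecidableEq ι] {X : Matrix ι ι ℝ}

/-- The sum of the entries of a symmetric matrix `X` over the unordered pairs in `U`. -/
noncomputable def pairSum (X : Matrix ι ι ℝ) (U : Finset ι) : ℝ :=
  (∑ i ∈ U, ∑ j ∈ U.erase i, X i j) / 2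

/-- The hafnian of the restriction of a symmetric matrix `X` to a four-element set `U`: every
perfect matching of `U` is met by four choices of an ordered first edge `(i, j)`. -/
noncomputable def hafnianFour (X : Matrix ι ι ℝ) (U : Finset ι) : ℝ :=
  (∑ i ∈ U, ∑ j ∈ U.erase i, X i j * pairSum X ((U.erase i).erase j)) / 4

lemma pairSum_pair (hX : X.IsSymm) {i j : ι} (hij : i ≠ j) : pairSum X {i, j} = X i j := by
  simp [pairSum, hij, hX.apply i j]

lemma sum_mul_pairSum_erase (hX : X.IsSymm) {a b c : ι} (hab : a ≠ b) (hac : a ≠ c) (hbc : b ≠ c)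
    (f : ι → ℝ) :
    ∑ y ∈ ({a, b, c} : Finset ι), f y * pairSum X (({a, b, c} : Finset ι).erase y) =
      f a * X b c + f b * X a c + f c * X a b := by
  have ha : ({a, b, c} : Finset ι).erase a = {b, c} := by grind
  have hb : ({a, b, c} : Finset ι).erase b = {a, c} := by grind
  have hc : ({a, b, c} : Finset ι).erase c = {a, b} := by grind
  rw [Finset.sum_insert (by simp [hab, hac]), Finset.sum_pair hbc, ha, hb, hc,
    pairSum_pair hX hab, pairSum_pair hX hac, pairSum_pair hX hbc, ← add_assoc]

lemma hafnianFour_insert (hX : X.IsSymm) {i j k l : ι} (hij : i ≠ j) (hik : i ≠ k) (hil : i ≠ l)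
    (hjk : j ≠ k) (hjl : j ≠ l) (hkl : k ≠ l) :
    hafnianFour X {i, j, k, l} = X i j * X k l + X i k * X j l + X i l * X j k := by
  have hi : ({i, j, k, l} : Finset ι).erase i = {j, k, l} := by grind
  have hj : ({i, j, k, l} : Finset ι).erase j = {i, k, l} := by grind
  have hk : ({i, j, k, l} : Finset ι).erase k = {i, j, l} := by grind
  have hl : ({i, j, k, l} : Finset ι).erase l = {i, j, k} := by grind
  rw [hafnianFour, Finset.sum_insert (by simp [hij, hik, hil]),
    Finset.sum_insert (by simp [hjk, hjl]), Finset.sum_pair hkl, hi, hj, hk, hl,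
    sum_mul_pairSum_erase hX hij hik hjk, sum_mul_pairSum_erase hX hij hil hjl,
    sum_mul_pairSum_erase hX hik hil hkl, sum_mul_pairSum_erase hX hjk hjl hkl,
    hX.apply i j, hX.apply i k, hX.apply i l, hX.apply j k, hX.apply j l, hX.apply k l]
  ring

variable [Fintype ι]

/-- The pseudoexpectation of the monomial `∏ i ∈ U, x i` attached to a correlation matrix `X`: a
damped Gaussian moment (damping `ρ`, inflation `η`) with a quartic correction in degree four. -/
noncomputable def pseudomoment (X : Matrix ι ι ℝ) (η ρ : ℝ) (U : Finset ι) : ℝ :=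
  match U.card with
  | 0 => 1
  | 2 => ρ * pairSum X U
  | 4 => ρ ^ 2 * ((1 + η) * hafnianFour X U - 2 * ∑ m, ∏ i ∈ U, X i m)
  | _ => 0

lemma pseudomoment_empty (X : Matrix ι ι ℝ) (η ρ : ℝ) : pseudomoment X η ρ ∅ = 1 := by
  simp [pseudomoment]

lemma pseudomoment_of_odd (X : Matrix ι ι ℝ) (η ρ : ℝ) {U : Finset ι} (hU : Odd U.card) :
    pseudomoment X η ρ U = 0 := by
  unfold pseudomoment
  split <;> simp_all [Nat.odd_iff]

lemma pseudomoment_pair (hX : X.IsSymm) (η ρ : ℝ) {i j : ι} (hij : i ≠ j) :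
    pseudomoment X η ρ {i, j} = ρ * X i j := by
  simp only [pseudomoment, Finset.card_pair hij, pairSum_pair hX hij]

lemma pseudomoment_four (hX : X.IsSymm) (η ρ : ℝ) {i j k l : ι} (hij : i ≠ j) (hik : i ≠ k)
    (hil : i ≠ l) (hjk : j ≠ k) (hjl : j ≠ l) (hkl : k ≠ l) :
    pseudomoment X η ρ {i, j, k, l} = ρ ^ 2 * quarticKernel X η (i, j) (k, l) := by
  have hi : i ∉ ({j, k, l} : Finset ι) := by simp [hij, hik, hil]
  have hj : j ∉ ({k, l} : Finset ι) := by simp [hjk, hjl]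
  have card_eq : ({i, j, k, l} : Finset ι).card = 4 := by
    rw [Finset.card_insert_of_notMem hi, Finset.card_insert_of_notMem hj, Finset.card_pair hkl]
  simp only [pseudomoment, card_eq, hafnianFour_insert hX hij hik hil hjk hjl hkl, quarticKernel,
    Finset.prod_insert hi, Finset.prod_insert hj, Finset.prod_pair hkl, mul_assoc]

end Pseudomoment

section PosSemidef

open scoped Matrix

variable {m n ι κ : Type*}

lemma posSemidef_fromBlocks_zero [Finite m] [Finite n]
    {A : Matrix m m ℝ} {D : Matrix n n ℝ} (hA : A.PosSemidef) (hD : D.PosSemidef) :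
    (Matrix.fromBlocks A 0 0 D).PosSemidef := by
  classical
  have := Fintype.ofFinite m
  have := Fintype.ofFinite n
  have split : Matrix.fromBlocks A 0 0 D =
      (Matrix.fromCols (1 : Matrix m m ℝ) (0 : Matrix m n ℝ))ᴴ * A *
          Matrix.fromCols (1 : Matrix m m ℝ) (0 : Matrix m n ℝ) +
        (Matrix.fromCols (0 : Matrix n m ℝ) (1 : Matrix n n ℝ))ᴴ * D *
          Matrix.fromCols (0 : Matrix n m ℝ) (1 : Matrix n n ℝ) := by
    ext (i | i) (j | j) <;>
      simp [Matrix.mul_apply, Matrix.fromCols, Matrix.one_apply]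
  exact split ▸ (hA.conjTranspose_mul_mul_same _).add (hD.conjTranspose_mul_mul_same _)

lemma posSemidef_blockDiagonal [Finite ι] [Finite κ] [DecidableEq κ]
    {G : κ → Matrix ι ι ℝ} (hG : ∀ k, (G k).PosSemidef) :
    (Matrix.blockDiagonal G).PosSemidef := by
  classical
  have := Fintype.ofFinite ι
  have := Fintype.ofFinite κ
  have split : Matrix.blockDiagonal G = ∑ k,
      ((1 : Matrix (ι × κ) (ι × κ) ℝ).submatrix (·, k) id)ᴴ * G k *
      ((1 : Matrix (ι × κ) (ι × κ) ℝ).submatrix (·, k) id) := by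
    ext ⟨i, k⟩ ⟨j, l⟩
    rcases eq_or_ne k l with rfl | hkl <;>
      simp [Matrix.mul_apply, Matrix.one_apply, Matrix.sum_apply, Matrix.blockDiagonal_apply,
        ite_and, *]
  exact split ▸ Matrix.posSemidef_sum _ fun k _ => (hG k).conjTranspose_mul_mul_same _

/-- The sum of the four matrices obtained from a matrix indexed by ordered pairs by reversing the
row pair, the column pair, or both. -/
def swapSum (A : Matrix (ι × ι) (ι × ι) ℝ) : Matrix (ι × ι) (ι × ι) ℝ :=
  Matrix.of fun p q => A p q + A p.swap q + A p q.swap + A p.swap q.swap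

lemma swapSum_swap_left (A : Matrix (ι × ι) (ι × ι) ℝ) (p q : ι × ι) :
    swapSum A p.swap q = swapSum A p q := by
  simp only [swapSum, Matrix.of_apply, Prod.swap_swap]; ring

lemma swapSum_swap_right (A : Matrix (ι × ι) (ι × ι) ℝ) (p q : ι × ι) :
    swapSum A p q.swap = swapSum A p q := by
  simp only [swapSum, Matrix.of_apply, Prod.swap_swap]; ring

lemma posSemidef_swapSum [Finite ι] {A : Matrix (ι × ι) (ι × ι) ℝ}
    (hA : A.PosSemidef) : (swapSum A).PosSemidef := by
  classical
  have := Fintype.ofFinite ι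
  have conj : swapSum A = (1 + (1 : Matrix (ι × ι) (ι × ι) ℝ).submatrix id Prod.swap)ᴴ
      * A * (1 + (1 : Matrix (ι × ι) (ι × ι) ℝ).submatrix id Prod.swap) := by
    ext p q
    simp only [swapSum, Matrix.of_apply, Matrix.conjTranspose_eq_transpose_of_trivial,
      Matrix.transpose_add, Matrix.transpose_one, Matrix.transpose_submatrix, add_mul, mul_add,
      one_mul, mul_one, Matrix.mul_apply, Matrix.add_apply, Matrix.submatrix_apply,
      Matrix.one_apply, id_eq, ite_mul, mul_ite, zero_mul, mul_zero, Finset.sum_ite_eq,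
      Finset.sum_ite_eq', Finset.mem_univ, ↓reduceIte, Finset.sum_add_distrib]
    ring
  exact conj ▸ hA.conjTranspose_mul_mul_same _

lemma posSemidef_sum_sq_smul_one_sub_vecMulVec [Fintype ι] [DecidableEq ι] (y : ι → ℝ) :
    ((∑ i, y i ^ 2) • (1 : Matrix ι ι ℝ) - Matrix.vecMulVec y y).PosSemidef := by
  refine .of_dotProduct_mulVec_nonneg ?_ fun x => ?_
  · ext i j; simp [Matrix.vecMulVec_apply, Matrix.one_apply, mul_comm, eq_comm]
  · have quadForm : star x ⬝ᵥ
        (((∑ i, y i ^ 2) • (1 : Matrix ι ι ℝ) - Matrix.vecMulVec y y) *ᵥ x) =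
        (∑ i, y i ^ 2) * ∑ i, x i ^ 2 - (∑ i, y i * x i) ^ 2 := by
      rw [Matrix.sub_mulVec, Matrix.smul_mulVec, Matrix.one_mulVec, Matrix.vecMulVec_mulVec,
        dotProduct_sub, dotProduct_smul, dotProduct_smul]
      simp [dotProduct, sq, mul_comm]
    exact quadForm ▸ sub_nonneg.2 (Finset.sum_mul_sq_le_sq_mul_sq Finset.univ y x)

end PosSemidef

section Overlap

open scoped Matrix

variable {ι : Type*} [DecidableEq ι] [Fintype ι] {X : Matrix ι ι ℝ} {η τ θ : ℝ}

/-- The correction making the degree-four kernel consistent on the pairs `{j, i}` and `{l, i}`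
that share the index `i`, as a matrix in `j` and `l`. The matrix `X - 1` is the off-diagonal part
of a correlation matrix `X`. -/
noncomputable def overlapKernel (X : Matrix ι ι ℝ) (η τ : ℝ) (i : ι) : Matrix ι ι ℝ :=
  Matrix.of fun j l => 2 * ∑ m, (X - 1) i m ^ 2 * (X j m * X l m)
    - 2 * η * ((X - 1) i j * (X - 1) i l) + (τ - η) * X j l
    + if j = l then (τ ^ 2 + η) / 2 + η * (X - 1) i j ^ 2 - ∑ m, (X - 1) i m ^ 2 * X j m ^ 2 else 0

/-- The total correction of the degree-four kernel on ordered pairs of indices. -/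
noncomputable def overlapCorrection (X : Matrix ι ι ℝ) (η τ : ℝ) : Matrix (ι × ι) (ι × ι) ℝ :=
  swapSum (Matrix.blockDiagonal (overlapKernel X η τ))

lemma sum_sub_one_sq_mul (hdiag : ∀ i, X i i = 1) (i : ι) (f : ι → ℝ) :
    ∑ m, (X - 1) i m ^ 2 * f m = ∑ m, X i m ^ 2 * f m - f i := by
  have entry (m : ι) : (X - 1) i m ^ 2 * f m = X i m ^ 2 * f m - if i = m then f m else 0 := by
    rcases eq_or_ne i m with rfl | him <;> simp [*]
  simp only [entry, Finset.sum_sub_distrib, Finset.sum_ite_eq, Finset.mem_univ, if_true]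

omit [Fintype ι] in
lemma sub_one_apply_of_ne {i j : ι} (hij : i ≠ j) : (X - 1) i j = X i j := by
  rw [Matrix.sub_apply, Matrix.one_apply_ne hij, sub_zero]

lemma overlapKernel_of_ne (hdiag : ∀ i, X i i = 1) {i j l : ι} (hij : i ≠ j) (hil : i ≠ l)
    (hjl : j ≠ l) :
    overlapKernel X η τ i j l = 2 * ∑ m, X i m ^ 2 * (X j m * X l m)
      - 2 * (X j i * X l i + η * (X i j * X i l)) + (τ - η) * X j l := by
  simp only [overlapKernel, Matrix.of_apply, sum_sub_one_sq_mul hdiag,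
    sub_one_apply_of_ne hij, sub_one_apply_of_ne hil, if_neg hjl]
  ring

lemma overlapKernel_self (hdiag : ∀ i, X i i = 1) {i j : ι} (hij : i ≠ j) :
    overlapKernel X η τ i j j = ∑ m, X i m ^ 2 * X j m ^ 2 - X j i ^ 2 - η * X i j ^ 2 + τ
      + (τ ^ 2 - η) / 2 := by
  simp only [overlapKernel, Matrix.of_apply, ← sq, sum_sub_one_sq_mul hdiag,
    sub_one_apply_of_ne hij, hdiag, if_true]
  ring

lemma overlapCorrection_of_disjoint (X : Matrix ι ι ℝ) (η τ : ℝ) {i j k l : ι} (hik : i ≠ k)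
    (hil : i ≠ l) (hjk : j ≠ k) (hjl : j ≠ l) : overlapCorrection X η τ (i, j) (k, l) = 0 := by
  simp [overlapCorrection, swapSum, Matrix.blockDiagonal_apply, *]

lemma quarticKernel_add_overlapCorrection_of_ne (hX : X.IsSymm) (hdiag : ∀ i, X i i = 1)
    {i j l : ι} (hij : i ≠ j) (hil : i ≠ l) (hjl : j ≠ l) :
    quarticKernel X η (j, i) (l, i) + overlapCorrection X η τ (j, i) (l, i) =
      (1 + τ) * X j l := by
  have correction_eq : overlapCorrection X η τ (j, i) (l, i) = overlapKernel X η τ i j l := by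
    simp [overlapCorrection, swapSum, Matrix.blockDiagonal_apply, hij.symm, hil, hjl]
  have quartic_sum : ∑ m, X j m * X i m * X l m * X i m = ∑ m, X i m ^ 2 * (X j m * X l m) :=
    Finset.sum_congr rfl fun m _ => by ring
  rw [correction_eq, overlapKernel_of_ne hdiag hij hil hjl, quarticKernel, quartic_sum, hdiag,
    hX.apply i j, hX.apply i l]
  ring

lemma quarticKernel_add_overlapCorrection_self (hX : X.IsSymm) (hdiag : ∀ i, X i i = 1)
    {i j : ι} (hij : i ≠ j) :
    quarticKernel X η (j, i) (j, i) + overlapCorrection X η τ (j, i) (j, i) = (1 + τ) ^ 2 := by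
  have correction_eq : overlapCorrection X η τ (j, i) (j, i) =
      overlapKernel X η τ i j j + overlapKernel X η τ j i i := by
    simp [overlapCorrection, swapSum, Matrix.blockDiagonal_apply, hij, hij.symm]
  have quartic_sum : ∑ m, X j m * X i m * X j m * X i m = ∑ m, X i m ^ 2 * X j m ^ 2 :=
    Finset.sum_congr rfl fun m _ => by ring
  have quartic_sum_comm : ∑ m, X j m ^ 2 * X i m ^ 2 = ∑ m, X i m ^ 2 * X j m ^ 2 :=
    Finset.sum_congr rfl fun m _ => mul_comm _ _
  rw [correction_eq, overlapKernel_self hdiag hij, overlapKernel_self hdiag hij.symm,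
    quarticKernel, quartic_sum, quartic_sum_comm, hdiag, hdiag, hX.apply i j]
  ring

lemma pseudomoment_symmDiff_common {ρ : ℝ} (hX : X.IsSymm) (hdiag : ∀ i, X i i = 1)
    (hρ : ρ * (1 + τ) = 1) {i j l : ι} (hij : i ≠ j) (hil : i ≠ l) :
    pseudomoment X η ρ (symmDiff {j, i} {l, i}) =
      ρ ^ 2 * (quarticKernel X η (j, i) (l, i) + overlapCorrection X η τ (j, i) (l, i)) := by
  rcases eq_or_ne j l with rfl | hjl
  · rw [symmDiff_self, Finset.bot_eq_empty, pseudomoment_empty,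
      quarticKernel_add_overlapCorrection_self hX hdiag hij, ← mul_pow, hρ, one_pow]
  · rw [symmDiff_pair_of_common hij hil hjl, pseudomoment_pair hX _ _ hjl,
      quarticKernel_add_overlapCorrection_of_ne hX hdiag hij hil hjl]
    linear_combination (-ρ * X j l) * hρ

lemma pseudomoment_symmDiff_pair {ρ : ℝ} (hX : X.IsSymm) (hdiag : ∀ i, X i i = 1)
    (hρ : ρ * (1 + τ) = 1) {p q : ι × ι} (hp : p.1 ≠ p.2) (hq : q.1 ≠ q.2) :
    pseudomoment X η ρ (symmDiff {p.1, p.2} {q.1, q.2}) =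
      ρ ^ 2 * (quarticKernel X η p q + overlapCorrection X η τ p q) := by
  have swap_left (p q : ι × ι) : quarticKernel X η p.swap q + overlapCorrection X η τ p.swap q =
      quarticKernel X η p q + overlapCorrection X η τ p q := by
    rw [quarticKernel_swap_left η hX, overlapCorrection, swapSum_swap_left]
  have swap_right (p q : ι × ι) : quarticKernel X η p q.swap + overlapCorrection X η τ p q.swap =
      quarticKernel X η p q + overlapCorrection X η τ p q := by
    rw [quarticKernel_swap_right η hX, overlapCorrection, swapSum_swap_right]
  obtain ⟨a, b⟩ := p
  obtain ⟨c, d⟩ := q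
  dsimp only at hp hq ⊢
  rcases eq_or_ne b d with rfl | hbd
  · exact pseudomoment_symmDiff_common hX hdiag hρ hp.symm hq.symm
  rcases eq_or_ne b c with rfl | hbc
  · rw [Finset.pair_comm b, ← swap_right]
    exact pseudomoment_symmDiff_common hX hdiag hρ hp.symm hq
  rcases eq_or_ne a d with rfl | had
  · rw [Finset.pair_comm a b, ← swap_left]
    exact pseudomoment_symmDiff_common hX hdiag hρ hp hq.symm
  rcases eq_or_ne a c with rfl | hac
  · rw [Finset.pair_comm a b, Finset.pair_comm a d, ← swap_left, ← swap_right]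
    exact pseudomoment_symmDiff_common hX hdiag hρ hp hq
  · rw [symmDiff_pair_of_disjoint hac had hbc hbd, pseudomoment_four hX _ _ hp hac had hbc hbd hq,
      overlapCorrection_of_disjoint X η τ hac had hbc hbd, add_zero]

variable (X η τ) in
lemma overlapKernel_eq_add (i : ι) :
    overlapKernel X η τ i =
      (2 : ℝ) • ∑ m, (X - 1) i m ^ 2 • Matrix.vecMulVec (fun j => X j m) (fun j => X j m)
      + (τ - η) • X
      + (2 * η) • ((∑ j, (X - 1) i j ^ 2) • 1 - Matrix.vecMulVec ((X - 1) i) ((X - 1) i))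
      + Matrix.diagonal fun j => (τ ^ 2 + η) / 2 + η * (X - 1) i j ^ 2
          - ∑ m, (X - 1) i m ^ 2 * X j m ^ 2 - 2 * η * ∑ m, (X - 1) i m ^ 2 := by
  unfold overlapKernel
  generalize X - 1 = Y
  ext j l
  simp only [Matrix.of_apply, Matrix.add_apply, Matrix.sub_apply, Matrix.smul_apply,
    Matrix.sum_apply, Matrix.vecMulVec_apply, Matrix.one_apply, Matrix.diagonal_apply, smul_eq_mul]
  split_ifs with hjl
  · subst hjl
    ring
  · ring

lemma sum_sub_one_sq_le (hdiag : ∀ i, X i i = 1) (hθ : 0 ≤ θ)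
    (hX : ∀ i j, i ≠ j → X i j ^ 2 ≤ θ) (i : ι) :
    ∑ j, (X - 1) i j ^ 2 ≤ Fintype.card ι * θ := by
  refine (Finset.sum_le_card_nsmul _ _ θ fun j _ => ?_).trans_eq (nsmul_eq_mul _ _)
  rcases eq_or_ne i j with rfl | hij
  · simpa [hdiag] using hθ
  · exact sub_one_apply_of_ne hij ▸ hX i j hij

lemma sum_sub_one_sq_mul_sq_le (hdiag : ∀ i, X i i = 1) (hθ : 0 ≤ θ)
    (hX : ∀ i j, i ≠ j → X i j ^ 2 ≤ θ) (i j : ι) :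
    ∑ m, (X - 1) i m ^ 2 * X j m ^ 2 ≤ θ + Fintype.card ι * θ ^ 2 := by
  have sub_one_sq_le (m : ι) : (X - 1) i m ^ 2 ≤ θ := by
    rcases eq_or_ne i m with rfl | him
    · simpa [hdiag] using hθ
    · exact sub_one_apply_of_ne him ▸ hX i m him
  have sq_le (m : ι) : X j m ^ 2 ≤ (if j = m then 1 else 0) + θ := by
    rcases eq_or_ne j m with rfl | hjm
    · simpa [hdiag] using hθ
    · simpa [hjm] using hX j m hjm
  calc ∑ m, (X - 1) i m ^ 2 * X j m ^ 2 ≤ ∑ m, θ * ((if j = m then 1 else 0) + θ) :=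
        Finset.sum_le_sum fun m _ => mul_le_mul (sub_one_sq_le m) (sq_le m) (sq_nonneg _) hθ
    _ = θ + Fintype.card ι * θ ^ 2 := by
        rw [← Finset.mul_sum, Finset.sum_add_distrib, Fintype.sum_ite_eq, Finset.sum_const,
          Finset.card_univ, nsmul_eq_mul]
        ring

lemma posSemidef_overlapKernel (hpos : X.PosSemidef) (hdiag : ∀ i, X i i = 1) (hη : 0 ≤ η)
    (hητ : η ≤ τ) (hθ : 0 ≤ θ) (hX : ∀ i j, i ≠ j → X i j ^ 2 ≤ θ)
    (hsmall : 2 * θ + 2 * Fintype.card ι * θ ^ 2 + 4 * η * Fintype.card ι * θ ≤ τ ^ 2) (i : ι) :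
    (overlapKernel X η τ i).PosSemidef := by
  have rank_one (m : ι) : (Matrix.vecMulVec (fun j => X j m) fun j => X j m).PosSemidef := by
    simpa using Matrix.posSemidef_vecMulVec_self_star fun j => X j m
  rw [overlapKernel_eq_add]
  refine (((Matrix.posSemidef_sum _ fun m _ => (rank_one m).smul (sq_nonneg _)).smul
    zero_le_two).add (hpos.smul (sub_nonneg.2 hητ))).add
    ((posSemidef_sum_sq_smul_one_sub_vecMulVec _).smul (by positivity)) |>.add
    (.diagonal fun j => ?_)
  have row := mul_le_mul_of_nonneg_left (sum_sub_one_sq_le hdiag hθ hX i) hη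
  have quartic := sum_sub_one_sq_mul_sq_le hdiag hθ hX i j
  have := mul_nonneg hη (sq_nonneg ((X - 1) i j))
  simp only [Pi.zero_apply]
  linarith

lemma posSemidef_overlapCorrection (hpos : X.PosSemidef) (hdiag : ∀ i, X i i = 1) (hη : 0 ≤ η)
    (hητ : η ≤ τ) (hθ : 0 ≤ θ) (hX : ∀ i j, i ≠ j → X i j ^ 2 ≤ θ)
    (hsmall : 2 * θ + 2 * Fintype.card ι * θ ^ 2 + 4 * η * Fintype.card ι * θ ≤ τ ^ 2) :
    (overlapCorrection X η τ).PosSemidef :=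
  posSemidef_swapSum <| posSemidef_blockDiagonal <|
    posSemidef_overlapKernel hpos hdiag hη hητ hθ hX hsmall

end Overlap

section PseudomomentMatrix

open scoped Matrix

variable {ι : Type*} [DecidableEq ι] [Fintype ι] {X : Matrix ι ι ℝ} {η τ θ ρ : ℝ}

/-- Half of what the degree-four kernel exceeds the products of degree-two moments by. -/
noncomputable def quarticGap (X : Matrix ι ι ℝ) (η : ℝ) : Matrix (ι × ι) (ι × ι) ℝ :=
  Matrix.of fun p q => (1 + η) / 2 * (X p.1 q.1 * X p.2 q.2 + X p.1 q.2 * X p.2 q.1)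
    + η / 2 * (X p.1 p.2 * X q.1 q.2) - ∑ m, X p.1 m * X p.2 m * X q.1 m * X q.2 m

/-- The pseudomoment matrix of the monomials of degree zero and of the products of two variables,
the latter indexed by ordered pairs. -/
noncomputable def evenBlock (X : Matrix ι ι ℝ) (η τ ρ : ℝ) :
    Matrix (Unit ⊕ ι × ι) (Unit ⊕ ι × ι) ℝ :=
  Matrix.fromBlocks 1 (Matrix.of fun _ p => ρ * X p.1 p.2) (Matrix.of fun p _ => ρ * X p.1 p.2)
    (ρ ^ 2 • (Matrix.of (quarticKernel X η) + overlapCorrection X η τ))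

/-- The pseudomoment matrix of all monomials of degree at most two, those of degree two being
indexed by ordered pairs; monomials of different parity are uncorrelated. -/
noncomputable def orderedMomentMatrix (X : Matrix ι ι ℝ) (η τ ρ : ℝ) :
    Matrix (ι ⊕ (Unit ⊕ ι × ι)) (ι ⊕ (Unit ⊕ ι × ι)) ℝ :=
  Matrix.fromBlocks (ρ • X + (1 - ρ) • 1) 0 0 (evenBlock X η τ ρ)

lemma posSemidef_evenBlock (hgap : (quarticGap X η).PosSemidef)
    (hcorr : (overlapCorrection X η τ).PosSemidef) : (evenBlock X η τ ρ).PosSemidef := by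
  set u : Unit ⊕ ι × ι → ℝ := Sum.elim 1 fun p => ρ * X p.1 p.2 with hu
  have split : evenBlock X η τ ρ = Matrix.vecMulVec u (star u) +
      Matrix.fromBlocks 0 0 0 (ρ ^ 2 • ((2 : ℝ) • quarticGap X η + overlapCorrection X η τ)) := by
    ext (_ | p) (_ | q)
    · simp [evenBlock, hu, Matrix.vecMulVec_apply]
    · simp [evenBlock, hu, Matrix.vecMulVec_apply]
    · simp [evenBlock, hu, Matrix.vecMulVec_apply]
    · simp only [evenBlock, quarticKernel, quarticGap, hu, Matrix.fromBlocks_apply₂₂,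
        Matrix.add_apply, Matrix.smul_apply, Matrix.of_apply, Matrix.vecMulVec_apply,
        star_trivial, Sum.elim_inr, smul_eq_mul]
      ring
  exact split ▸ (Matrix.posSemidef_vecMulVec_self_star u).add
    (posSemidef_fromBlocks_zero .zero (((hgap.smul zero_le_two).add hcorr).smul (sq_nonneg ρ)))

/-- The set of variables occurring in an ordered monomial. -/
def indexSet : ι ⊕ (Unit ⊕ ι × ι) → Finset ι
  | .inl i => {i}
  | .inr (.inl _) => ∅
  | .inr (.inr p) => {p.1, p.2}

omit [Fintype ι] in
lemma exists_indexSet_eq {S : Finset ι} (hS : S.card ≤ 2) :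
    ∃ s : ι ⊕ (Unit ⊕ ι × ι), indexSet s = S ∧ ∀ p, s = .inr (.inr p) → p.1 ≠ p.2 := by
  interval_cases hcard : S.card
  · exact ⟨.inr (.inl ()), by simp_all [indexSet]⟩
  · obtain ⟨i, rfl⟩ := Finset.card_eq_one.1 hcard
    exact ⟨.inl i, by simp [indexSet]⟩
  · obtain ⟨i, j, hij, rfl⟩ := Finset.card_eq_two.1 hcard
    exact ⟨.inr (.inr (i, j)), by simp [indexSet, hij]⟩

lemma pseudomoment_symmDiff_singleton (hX : X.IsSymm) (hdiag : ∀ i, X i i = 1) (i j : ι) :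
    pseudomoment X η ρ (symmDiff {i} {j}) = (ρ • X + (1 - ρ) • 1) i j := by
  rcases eq_or_ne i j with rfl | hij
  · simp [pseudomoment_empty, hdiag]
  · simp [symmDiff_singleton_of_ne hij, pseudomoment_pair hX _ _ hij, hij]

lemma pseudomoment_symmDiff_indexSet (hX : X.IsSymm) (hdiag : ∀ i, X i i = 1)
    (hρ : ρ * (1 + τ) = 1) {s t : ι ⊕ (Unit ⊕ ι × ι)} (hs : ∀ p, s = .inr (.inr p) → p.1 ≠ p.2)
    (ht : ∀ p, t = .inr (.inr p) → p.1 ≠ p.2) :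
    pseudomoment X η ρ (symmDiff (indexSet s) (indexSet t)) = orderedMomentMatrix X η τ ρ s t := by
  rcases s with i | _ | p <;> rcases t with j | _ | q
  · exact pseudomoment_symmDiff_singleton hX hdiag i j
  · exact pseudomoment_of_odd _ _ _ (odd_card_symmDiff (by simp [indexSet]))
  · exact pseudomoment_of_odd _ _ _
      (odd_card_symmDiff (by
        rw [indexSet, indexSet, Finset.card_singleton, Finset.card_pair (ht q rfl)]; decide))
  · exact pseudomoment_of_odd _ _ _ (odd_card_symmDiff (by simp [indexSet]))
  · simp [indexSet, orderedMomentMatrix, evenBlock, pseudomoment_empty]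
  · simp [indexSet, orderedMomentMatrix, evenBlock, pseudomoment_pair hX _ _ (ht q rfl), symmDiff]
  · exact pseudomoment_of_odd _ _ _
      (odd_card_symmDiff (by
        rw [indexSet, indexSet, Finset.card_singleton, Finset.card_pair (hs p rfl)]; decide))
  · simp [indexSet, orderedMomentMatrix, evenBlock, pseudomoment_pair hX _ _ (hs p rfl), symmDiff]
  · exact pseudomoment_symmDiff_pair hX hdiag hρ (hs p rfl) (ht q rfl)

end PseudomomentMatrix

lemma isSoS4_pseudomoment {n : ℕ} {X : Matrix (Fin n) (Fin n) ℝ} {η τ θ : ℝ}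
    (hpos : X.PosSemidef) (hdiag : ∀ i, X i i = 1) (hη : 0 ≤ η)
    (hητ : η ≤ τ) (hθ : 0 ≤ θ) (hX : ∀ i j, i ≠ j → X i j ^ 2 ≤ θ)
    (hsmall : 2 * θ + 2 * n * θ ^ 2 + 4 * η * n * θ ≤ τ ^ 2) (hgap : (quarticGap X η).PosSemidef) :
    IsSoS4 (Matrix.of fun S T : SmallSet n =>
      pseudomoment X η (1 + τ)⁻¹ (symmDiff S.1 T.1)) where
  symm S T S' T' h := by simp only [Matrix.of_apply, h]
  normalized := by simp [SmallSet.empty, pseudomoment_empty]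
  posSemidef := by
    have hτ : 0 ≤ τ := hη.trans hητ
    have hρ : (1 + τ)⁻¹ * (1 + τ) = 1 := inv_mul_cancel₀ (by positivity)
    have hsymm : X.IsSymm := by simpa [Matrix.IsSymm] using hpos.isHermitian
    have blocks : (orderedMomentMatrix X η τ (1 + τ)⁻¹).PosSemidef := by
      have hρ_le : (1 + τ)⁻¹ ≤ 1 := inv_le_one_of_one_le₀ (by linarith)
      exact posSemidef_fromBlocks_zero
        ((hpos.smul (by positivity)).add (Matrix.PosSemidef.one.smul (sub_nonneg.2 hρ_le)))
        (posSemidef_evenBlock hgap (posSemidef_overlapCorrection hpos hdiag hη hητ hθ hX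
          (by simpa using hsmall)))
    choose e he_set he_ne using fun S : SmallSet n => exists_indexSet_eq S.2
    convert blocks.submatrix e
    ext S T
    rw [Matrix.of_apply, ← he_set S, ← he_set T]
    exact pseudomoment_symmDiff_indexSet hsymm hdiag hρ (he_ne S) (he_ne T)

section Tensor

open scoped Matrix Matrix.Norms.L2Operator TensorProduct
open InnerProductSpace

variable {ι E : Type*} [Fintype ι] [DecidableEq ι] [NormedAddCommGroup E] [InnerProductSpace ℝ E]

lemma sum_inner_sq_le_norm_gram_mul (s : ι → E) (a : E) :
    ∑ m, inner ℝ (s m) a ^ 2 ≤ ‖Matrix.gram ℝ s‖ * ‖a‖ ^ 2 := by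
  set β : EuclideanSpace ℝ ι := WithLp.toLp 2 fun m => inner ℝ (s m) a
  have norm_β : ∑ m, inner ℝ (s m) a ^ 2 = ‖β‖ ^ 2 := (EuclideanSpace.real_norm_sq_eq β).symm
  have norm_sum : ‖∑ m, β m • s m‖ ^ 2 ≤ ‖Matrix.gram ℝ s‖ * ‖β‖ ^ 2 := by
    calc ‖∑ m, β m • s m‖ ^ 2 = inner ℝ (WithLp.toLp 2 (Matrix.gram ℝ s *ᵥ β)) β := by
          rw [← real_inner_self_eq_norm_sq, ← Matrix.star_dotProduct_gram_mulVec]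
          simp [EuclideanSpace.inner_eq_star_dotProduct]
      _ ≤ ‖Matrix.gram ℝ s‖ * ‖β‖ * ‖β‖ :=
          (real_inner_le_norm _ _).trans <| by gcongr; exact Matrix.l2_opNorm_mulVec _ β
      _ = ‖Matrix.gram ℝ s‖ * ‖β‖ ^ 2 := by ring
  have inner_sum_eq : ‖β‖ ^ 2 = inner ℝ (∑ m, β m • s m) a := by
    rw [← norm_β, sum_inner]
    exact Finset.sum_congr rfl fun m _ => by rw [real_inner_smul_left, sq]
  have cauchy_schwarz : (‖β‖ ^ 2) ^ 2 ≤ ‖Matrix.gram ℝ s‖ * ‖β‖ ^ 2 * ‖a‖ ^ 2 := by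
    calc (‖β‖ ^ 2) ^ 2 ≤ (‖∑ m, β m • s m‖ * ‖a‖) ^ 2 := by
          gcongr; exact inner_sum_eq ▸ real_inner_le_norm _ _
      _ ≤ _ := by rw [mul_pow]; gcongr
  rw [norm_β]
  rcases (sq_nonneg ‖β‖).eq_or_lt with hzero | hpos
  · rw [← hzero]; positivity
  · nlinarith

/-- The off-diagonal matrix of the centred squared correlations `⟪v i, v j⟫ ^ 2 - 1 / dim E`. -/
noncomputable def centeredSq (v : ι → E) : Matrix ι ι ℝ :=
  Matrix.of fun i j => if i = j then 0 else inner ℝ (v i) (v j) ^ 2 - (Module.finrank ℝ E : ℝ)⁻¹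

variable [FiniteDimensional ℝ E]

lemma inner_canonicalCovariantTensor_tmul (a b : E) :
    inner ℝ (canonicalCovariantTensor E) (a ⊗ₜ[ℝ] b) = inner ℝ a b := by
  rw [canonicalCovariantTensor_eq_sum E (stdOrthonormalBasis ℝ E), sum_inner,
    ← (stdOrthonormalBasis ℝ E).sum_inner_mul_inner a b]
  simp [TensorProduct.inner_tmul, real_inner_comm]

lemma inner_canonicalCovariantTensor_self :
    inner ℝ (canonicalCovariantTensor E) (canonicalCovariantTensor E) =
      (Module.finrank ℝ E : ℝ) := by
  nth_rewrite 2 [canonicalCovariantTensor_eq_sum E (stdOrthonormalBasis ℝ E)]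
  simp [inner_sum, inner_canonicalCovariantTensor_tmul]

/-- The traceless part `v ⊗ v - I / dim E` of the tensor square of a vector. -/
noncomputable def tracelessSq (v : E) : E ⊗[ℝ] E :=
  v ⊗ₜ v - (Module.finrank ℝ E : ℝ)⁻¹ • canonicalCovariantTensor E

lemma inner_tracelessSq [Nontrivial E] {v w : E} (hv : ‖v‖ = 1) (hw : ‖w‖ = 1) :
    inner ℝ (tracelessSq v) (tracelessSq w) = inner ℝ v w ^ 2 - (Module.finrank ℝ E : ℝ)⁻¹ := by
  have finrank_ne_zero : (Module.finrank ℝ E : ℝ) ≠ 0 := by exact_mod_cast Module.finrank_pos.ne'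
  have tmul_inner : inner ℝ (v ⊗ₜ[ℝ] v) (canonicalCovariantTensor E) = (1 : ℝ) := by
    rw [real_inner_comm (F := E ⊗[ℝ] E), inner_canonicalCovariantTensor_tmul,
      real_inner_self_eq_norm_sq, hv, one_pow]
  simp only [tracelessSq, inner_sub_left, inner_sub_right,
    real_inner_smul_left (F := E ⊗[ℝ] E), real_inner_smul_right (F := E ⊗[ℝ] E),
    TensorProduct.inner_tmul, tmul_inner, inner_canonicalCovariantTensor_tmul,
    inner_canonicalCovariantTensor_self, real_inner_self_eq_norm_sq w, hw]
  field_simp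
  ring

lemma norm_gram_tracelessSq_le [Nontrivial E] {v : ι → E} (hv : ∀ i, ‖v i‖ = 1) :
    ‖Matrix.gram ℝ fun i => tracelessSq (v i)‖ ≤ 1 + ‖centeredSq v‖ := by
  have finrank_inv_mem : 0 ≤ (Module.finrank ℝ E : ℝ)⁻¹ ∧ (Module.finrank ℝ E : ℝ)⁻¹ ≤ 1 :=
    ⟨by positivity, Nat.cast_inv_le_one _⟩
  have gram_eq : (Matrix.gram ℝ fun i => tracelessSq (v i)) =
      Matrix.diagonal (fun _ => 1 - (Module.finrank ℝ E : ℝ)⁻¹) + centeredSq v := by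
    ext i j
    rw [Matrix.gram_apply, inner_tracelessSq (hv i) (hv j)]
    rcases eq_or_ne i j with rfl | hij
    · simp [centeredSq, hv]
    · simp [centeredSq, hij]
  rw [gram_eq]
  refine (norm_add_le _ _).trans (add_le_add_left ?_ _)
  rw [Matrix.l2_opNorm_diagonal]
  refine (pi_norm_le_iff_of_nonneg zero_le_one).2 fun _ => ?_
  rw [Real.norm_of_nonneg] <;> linarith

lemma sum_inner_tmul_self_sq_le [Nontrivial E] {v : ι → E} (hv : ∀ i, ‖v i‖ = 1) {η : ℝ}
    (hη : 0 < η) (hη1 : η ≤ 1)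
    (hdim : (1 + 3 / η) * (Fintype.card ι / (Module.finrank ℝ E : ℝ) ^ 2) ≤ η / 2)
    (hspec : ‖centeredSq v‖ ≤ η / 3) (A : E ⊗[ℝ] E) :
    ∑ m, inner ℝ (v m ⊗ₜ v m) A ^ 2 ≤
      (1 + η) * ‖A‖ ^ 2 + η / 2 * inner ℝ (canonicalCovariantTensor E) A ^ 2 := by
  set d : ℝ := (Module.finrank ℝ E : ℝ)
  set t : ℝ := inner ℝ (canonicalCovariantTensor E) A
  have traceless_sum : ∑ m, inner ℝ (tracelessSq (v m)) A ^ 2 ≤ (1 + η / 3) * ‖A‖ ^ 2 :=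
    (sum_inner_sq_le_norm_gram_mul _ A).trans <| by
      gcongr; exact (norm_gram_tracelessSq_le hv).trans (by gcongr)
  -- AM-GM: `2 x (t / d) ≤ (η / 3) x ^ 2 + (3 / η) (t / d) ^ 2`.
  have inner_sq_le (m : ι) : inner ℝ (v m ⊗ₜ v m) A ^ 2 ≤
      (1 + η / 3) * inner ℝ (tracelessSq (v m)) A ^ 2 + (1 + 3 / η) * (t / d) ^ 2 := by
    set x : ℝ := inner ℝ (tracelessSq (v m)) A with hx
    have inner_eq : inner ℝ (v m ⊗ₜ v m) A = x + t / d := by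
      rw [hx, tracelessSq, inner_sub_left, real_inner_smul_left (F := E ⊗[ℝ] E)]; ring
    have square_nonneg : 0 ≤ 3 / η * (η / 3 * x - t / d) ^ 2 := by positivity
    have square_eq : 3 / η * (η / 3 * x - t / d) ^ 2 =
        η / 3 * x ^ 2 + 3 / η * (t / d) ^ 2 - 2 * (x * (t / d)) := by field_simp; ring
    rw [inner_eq]
    linarith
  calc ∑ m, inner ℝ (v m ⊗ₜ v m) A ^ 2
      ≤ ∑ m, ((1 + η / 3) * inner ℝ (tracelessSq (v m)) A ^ 2 + (1 + 3 / η) * (t / d) ^ 2) :=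
        Finset.sum_le_sum fun m _ => inner_sq_le m
    _ = (1 + η / 3) * ∑ m, inner ℝ (tracelessSq (v m)) A ^ 2 +
          (1 + 3 / η) * (Fintype.card ι / d ^ 2) * t ^ 2 := by
      rw [Finset.sum_add_distrib, ← Finset.mul_sum, Finset.sum_const, Finset.card_univ,
        nsmul_eq_mul]
      ring
    _ ≤ (1 + η / 3) * ((1 + η / 3) * ‖A‖ ^ 2) + η / 2 * t ^ 2 := by gcongr
    _ ≤ (1 + η) * ‖A‖ ^ 2 + η / 2 * t ^ 2 := by
      rw [← mul_assoc]; gcongr; nlinarith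

/-- The symmetric part of the tensor `v i ⊗ v j`. -/
noncomputable def symTensor (v : ι → E) (p : ι × ι) : E ⊗[ℝ] E :=
  (2 : ℝ)⁻¹ • (v p.1 ⊗ₜ v p.2 + v p.2 ⊗ₜ v p.1)

omit [Fintype ι] [DecidableEq ι] [FiniteDimensional ℝ E] in
lemma inner_tmul_symTensor (a b : E) (v : ι → E) (p : ι × ι) :
    inner ℝ (a ⊗ₜ[ℝ] b) (symTensor v p) =
      2⁻¹ * (inner ℝ a (v p.1) * inner ℝ b (v p.2) + inner ℝ a (v p.2) * inner ℝ b (v p.1)) := by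
  simp only [symTensor, real_inner_smul_right (F := E ⊗[ℝ] E), inner_add_right,
    TensorProduct.inner_tmul]

omit [Fintype ι] [DecidableEq ι] in
lemma inner_canonicalCovariantTensor_symTensor (v : ι → E) (p : ι × ι) :
    inner ℝ (canonicalCovariantTensor E) (symTensor v p) = inner ℝ (v p.1) (v p.2) := by
  simp only [symTensor, real_inner_smul_right (F := E ⊗[ℝ] E), inner_add_right,
    inner_canonicalCovariantTensor_tmul, real_inner_comm (v p.1)]
  ring

omit [DecidableEq ι] in
lemma quarticGap_gram_eq (v : ι → E) (η : ℝ) :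
    quarticGap (Matrix.gram ℝ v) η = (1 + η) • Matrix.gram ℝ (symTensor v) +
      (η / 2) • Matrix.vecMulVec (fun p => inner ℝ (canonicalCovariantTensor E) (symTensor v p))
        (fun p => inner ℝ (canonicalCovariantTensor E) (symTensor v p)) -
      ∑ m, Matrix.vecMulVec (fun p => inner ℝ (v m ⊗ₜ[ℝ] v m) (symTensor v p))
        (fun p => inner ℝ (v m ⊗ₜ[ℝ] v m) (symTensor v p)) := by
  have inner_symTensor (p q : ι × ι) : inner ℝ (symTensor v p) (symTensor v q) =
      2⁻¹ * (inner ℝ (v p.1) (v q.1) * inner ℝ (v p.2) (v q.2) +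
        inner ℝ (v p.1) (v q.2) * inner ℝ (v p.2) (v q.1)) := by
    rw [symTensor, real_inner_smul_left (F := E ⊗[ℝ] E), inner_add_left, inner_tmul_symTensor,
      inner_tmul_symTensor]
    ring
  ext p q
  simp only [quarticGap, Matrix.of_apply, Matrix.sub_apply, Matrix.add_apply, Matrix.smul_apply,
    Matrix.sum_apply, Matrix.gram_apply, inner_symTensor, inner_tmul_symTensor,
    inner_canonicalCovariantTensor_symTensor, Matrix.vecMulVec_apply, smul_eq_mul]
  congr 1
  · ring
  · exact Finset.sum_congr rfl fun m _ => by simp only [real_inner_comm (v m)]; ring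

lemma posSemidef_quarticGap_gram [Nontrivial E] {v : ι → E} (hv : ∀ i, ‖v i‖ = 1) {η : ℝ}
    (hη : 0 < η) (hη1 : η ≤ 1)
    (hdim : (1 + 3 / η) * (Fintype.card ι / (Module.finrank ℝ E : ℝ) ^ 2) ≤ η / 2)
    (hspec : ‖centeredSq v‖ ≤ η / 3) : (quarticGap (Matrix.gram ℝ v) η).PosSemidef := by
  have hermitian_gap : (quarticGap (Matrix.gram ℝ v) η).IsHermitian := by
    ext p q
    simp only [quarticGap, Matrix.conjTranspose_apply, Matrix.of_apply, Matrix.gram_apply,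
      star_trivial]
    rw [real_inner_comm (v p.1) (v q.1), real_inner_comm (v p.1) (v q.2),
      real_inner_comm (v p.2) (v q.1), real_inner_comm (v p.2) (v q.2)]
    congr 1
    · ring
    · exact Finset.sum_congr rfl fun m _ => by ring
  refine .of_dotProduct_mulVec_nonneg hermitian_gap fun x => ?_
  set A : E ⊗[ℝ] E := ∑ p, x p • symTensor v p with hA
  have dotProduct_inner (B : E ⊗[ℝ] E) :
      x ⬝ᵥ (fun p => inner ℝ B (symTensor v p)) = inner ℝ B A := by
    rw [hA, inner_sum (E := E ⊗[ℝ] E)]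
    exact Finset.sum_congr rfl fun p _ => (real_inner_smul_right (F := E ⊗[ℝ] E) _ _ _).symm
  have gram_form : x ⬝ᵥ Matrix.gram ℝ (symTensor v) *ᵥ x = ‖A‖ ^ 2 := by
    rw [← real_inner_self_eq_norm_sq]
    exact Matrix.star_dotProduct_gram_mulVec (𝕜 := ℝ) (E := E ⊗[ℝ] E) _ x x
  have vecMulVec_form (B : E ⊗[ℝ] E) : x ⬝ᵥ Matrix.vecMulVec
      (fun p => inner ℝ B (symTensor v p)) (fun p => inner ℝ B (symTensor v p)) *ᵥ x =
      inner ℝ B A ^ 2 := by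
    rw [Matrix.vecMulVec_mulVec, dotProduct_smul, dotProduct_comm _ x, dotProduct_inner]
    simp [sq]
  rw [quarticGap_gram_eq, star_trivial]
  simp only [Matrix.sub_mulVec, Matrix.add_mulVec, Matrix.smul_mulVec, Matrix.sum_mulVec,
    dotProduct_sub, dotProduct_add, dotProduct_smul, dotProduct_sum, gram_form, vecMulVec_form,
    smul_eq_mul]
  linarith [sum_inner_tmul_self_sq_le hv hη hη1 hdim hspec A]

end Tensor

section SpectralBound

open scoped Matrix Matrix.Norms.L2Operator

variable {ι κ : Type*} [Fintype ι] [DecidableEq ι] [Fintype κ] [DecidableEq κ]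

omit [DecidableEq ι] in
lemma sq_l2_opNorm_le_sum_sq (A : Matrix ι κ ℝ) : ‖A‖ ^ 2 ≤ ∑ i, ∑ j, A i j ^ 2 := by
  have sum_nonneg : 0 ≤ ∑ i, ∑ j, A i j ^ 2 := by positivity
  rw [← Real.le_sqrt (norm_nonneg A) sum_nonneg, Matrix.l2_opNorm_def]
  refine ContinuousLinearMap.opNorm_le_bound _ (Real.sqrt_nonneg _) fun x => ?_
  refine (sq_le_sq₀ (norm_nonneg _) (by positivity)).1 ?_
  rw [mul_pow, Real.sq_sqrt sum_nonneg, EuclideanSpace.real_norm_sq_eq,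
    EuclideanSpace.real_norm_sq_eq, Finset.sum_mul]
  exact Finset.sum_le_sum fun i _ => Finset.sum_mul_sq_le_sq_mul_sq _ _ _

/-- The squared Frobenius norm of the off-diagonal part of `Y * Y`. -/
def sqOffDiag (Y : Matrix ι ι ℝ) : ℝ :=
  ∑ q ∈ (Finset.univ : Finset ι).offDiag, (Y * Y) q.1 q.2 ^ 2

lemma sq_l2_opNorm_le_of_isSymm {Y : Matrix ι ι ℝ} (hY : Y.IsSymm) {r f : ℝ}
    (hr : 0 ≤ r) (hf : 0 ≤ f) (hrow : ∀ i, ∑ j, Y i j ^ 2 ≤ r) (hoff : sqOffDiag Y ≤ f ^ 2) :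
    ‖Y‖ ^ 2 ≤ r + f := by
  set off : Matrix ι ι ℝ := Matrix.of fun i j => if i = j then 0 else (Y * Y) i j with off_def
  have square_eq : Yᴴ * Y = Matrix.diagonal (fun i => ∑ j, Y i j ^ 2) + off := by
    rw [Matrix.conjTranspose_eq_transpose_of_trivial, hY.eq]
    ext i j
    rcases eq_or_ne i j with rfl | hij
    · simp [off_def, Matrix.mul_apply, sq, hY.apply]
    · simp [off_def, hij]
  have norm_off : ‖off‖ ≤ f := by
    refine abs_le_of_sq_le_sq' ((sq_l2_opNorm_le_sum_sq off).trans (le_of_eq_of_le ?_ hoff)) hf |>.2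
    rw [← Fintype.sum_prod_type', sqOffDiag,
      ← Finset.sum_subset (Finset.subset_univ Finset.univ.offDiag) fun q _ hq => by
        simp [off_def, show q.1 = q.2 by simpa using hq]]
    exact Finset.sum_congr rfl fun q hq => by simp [off_def, (Finset.mem_offDiag.1 hq).2.2]
  calc ‖Y‖ ^ 2 = ‖Yᴴ * Y‖ := by rw [Matrix.l2_opNorm_conjTranspose_mul_self, sq]
    _ ≤ ‖Matrix.diagonal fun i => ∑ j, Y i j ^ 2‖ + ‖off‖ := square_eq ▸ norm_add_le _ _
    _ ≤ r + f := by
      refine add_le_add ?_ norm_off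
      rw [Matrix.l2_opNorm_diagonal, pi_norm_le_iff_of_nonneg hr]
      exact fun i =>
        (Real.norm_of_nonneg (Finset.sum_nonneg fun j _ => sq_nonneg _)).trans_le (hrow i)

variable {E : Type*} [NormedAddCommGroup E] [InnerProductSpace ℝ E]

omit [Fintype ι] in
lemma isSymm_centeredSq (v : ι → E) : (centeredSq v).IsSymm := by
  ext i j
  simp only [centeredSq, Matrix.transpose_apply, Matrix.of_apply, eq_comm (a := j),
    real_inner_comm (v i)]

lemma sum_centeredSq_sq_le {v : ι → E} {θ : ℝ} (hdim : (Module.finrank ℝ E : ℝ)⁻¹ ≤ θ)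
    (hcorr : ∀ i j, i ≠ j → inner ℝ (v i) (v j) ^ 2 ≤ θ) (i : ι) :
    ∑ j, centeredSq v i j ^ 2 ≤ Fintype.card ι * θ ^ 2 := by
  have finrank_inv_nonneg : (0 : ℝ) ≤ (Module.finrank ℝ E : ℝ)⁻¹ := by positivity
  have entry_le (j : ι) : centeredSq v i j ^ 2 ≤ θ ^ 2 := by
    rcases eq_or_ne i j with rfl | hij
    · simpa [centeredSq] using sq_nonneg θ
    · have corr_nonneg := sq_nonneg (inner ℝ (v i) (v j) : ℝ)
      rw [centeredSq, Matrix.of_apply, if_neg hij]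
      exact sq_le_sq' (by linarith) (by linarith [hcorr i j hij])
  simpa using Finset.sum_le_card_nsmul Finset.univ _ _ fun j _ => entry_le j

lemma norm_centeredSq_le {v : ι → E} {θ f η : ℝ} (hη : 0 ≤ η) (hf : 0 ≤ f)
    (hdim : (Module.finrank ℝ E : ℝ)⁻¹ ≤ θ)
    (hcorr : ∀ i j, i ≠ j → inner ℝ (v i) (v j) ^ 2 ≤ θ) (hoff : sqOffDiag (centeredSq v) ≤ f ^ 2)
    (hsmall : Fintype.card ι * θ ^ 2 + f ≤ (η / 3) ^ 2) : ‖centeredSq v‖ ≤ η / 3 :=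
  (abs_le_of_sq_le_sq' ((sq_l2_opNorm_le_of_isSymm (isSymm_centeredSq v) (by positivity) hf
    (sum_centeredSq_sq_le hdim hcorr) hoff).trans hsmall) (by positivity)).2

end SpectralBound

section Value

open Module

section StarProjection

variable {F : Type*} [NormedAddCommGroup F] [InnerProductSpace ℝ F]

lemma real_inner_starProjection_ge (V : Submodule ℝ F) [V.HasOrthogonalProjection] (c : F) {w : F}
    (hw : w ∈ V) : ‖c‖ ^ 2 - ‖c - w‖ ^ 2 ≤ inner ℝ c (V.starProjection c) := by
  have inner_w : inner ℝ c w = inner ℝ (V.starProjection c) w := by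
    rw [← sub_eq_zero, ← inner_sub_left, V.starProjection_inner_eq_zero c w hw]
  have inner_proj : inner ℝ c (V.starProjection c) = ‖V.starProjection c‖ ^ 2 := by
    rw [← real_inner_self_eq_norm_sq, ← sub_eq_zero, ← inner_sub_left,
      V.starProjection_inner_eq_zero c _ (V.starProjection_apply_mem c)]
  have defect := norm_sub_sq_real (V.starProjection c) w
  rw [norm_sub_sq_real, inner_w, inner_proj]
  linarith [sq_nonneg ‖V.starProjection c - w‖]

end StarProjection

lemma linearMap_apply_eq_sum_single {n : ℕ}
    (L : EuclideanSpace ℝ (Fin n) →ₗ[ℝ] EuclideanSpace ℝ (Fin n)) (c : EuclideanSpace ℝ (Fin n))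
    (i : Fin n) : L c i = ∑ j, L (EuclideanSpace.single j 1) i * c j := by
  conv_lhs => rw [← (EuclideanSpace.basisFun (Fin n) ℝ).sum_repr c, map_sum]
  simp [mul_comm]

variable {n : ℕ} (V : Submodule ℝ (EuclideanSpace ℝ (Fin n)))

lemma starProjection_apply_eq_sum (c : EuclideanSpace ℝ (Fin n)) (i : Fin n) :
    V.starProjection c i = ∑ j, projMatrix V i j * c j :=
  linearMap_apply_eq_sum_single V.starProjection.toLinearMap c i

lemma sum_projMatrix_mul_mul (c : EuclideanSpace ℝ (Fin n)) :
    ∑ i, ∑ j, projMatrix V i j * (c i * c j) = inner ℝ c (V.starProjection c) := by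
  simp only [PiLp.inner_apply, starProjection_apply_eq_sum, RCLike.inner_apply, conj_trivial,
    Finset.sum_mul]
  exact Finset.sum_congr rfl fun i _ => Finset.sum_congr rfl fun j _ => by ring

lemma projMatrix_diag_nonneg (i : Fin n) : 0 ≤ projMatrix V i i := by
  have quadForm_nonneg := real_inner_starProjection_ge V (EuclideanSpace.single i 1) V.zero_mem
  rw [sub_zero, sub_self, ← sum_projMatrix_mul_mul] at quadForm_nonneg
  simpa [Pi.single_apply] using quadForm_nonneg

variable {ι E : Type*} [Fintype ι] [NormedAddCommGroup E] [InnerProductSpace ℝ E]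

/-- The analysis operator `e ↦ (⟪x i, e⟫)ᵢ` of a family of vectors; over an orthonormal basis its
values are the columns of the matrix with rows `x i`. -/
noncomputable def analysisMap (x : ι → E) : E →ₗ[ℝ] EuclideanSpace ℝ ι where
  toFun e := WithLp.toLp 2 fun i => inner ℝ (x i) e
  map_add' _ _ := by ext; exact inner_add_right _ _ _
  map_smul' _ _ := by ext; exact real_inner_smul_right _ _ _

omit [Fintype ι] in
lemma analysisMap_apply (x : ι → E) (e : E) (i : ι) : analysisMap x e i = inner ℝ (x i) e := rfl

omit [Fintype ι] in
lemma analysisMap_sub (x y : ι → E) : analysisMap (x - y) = analysisMap x - analysisMap y := by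
  ext e i
  exact inner_sub_left _ _ _

omit [Fintype ι] in
lemma analysisMap_smul (c : ℝ) (x : ι → E) : analysisMap (c • x) = c • analysisMap x := by
  ext e i
  exact real_inner_smul_left _ _ _

lemma sum_norm_analysisMap_sq {κ : Type*} [Fintype κ] (b : OrthonormalBasis κ ℝ E) (x : ι → E) :
    ∑ a, ‖analysisMap x (b a)‖ ^ 2 = ∑ i, ‖x i‖ ^ 2 := by
  simp only [EuclideanSpace.real_norm_sq_eq, analysisMap_apply]
  rw [Finset.sum_comm]
  exact Finset.sum_congr rfl fun i _ => b.sum_sq_inner_left _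

lemma sum_projMatrix_mul_gram_ge [FiniteDimensional ℝ E] (v w : Fin n → E)
    (hw : LinearMap.range (analysisMap w) ≤ V) :
    ∑ i, ‖v i‖ ^ 2 - ∑ i, ‖v i - w i‖ ^ 2 ≤ ∑ i, ∑ j, projMatrix V i j * Matrix.gram ℝ v i j := by
  set b := stdOrthonormalBasis ℝ E
  have gram_eq (i j : Fin n) :
      Matrix.gram ℝ v i j = ∑ a, analysisMap v (b a) i * analysisMap v (b a) j := by
    simp only [Matrix.gram_apply, analysisMap_apply, real_inner_comm (b _) (v j),
      b.sum_inner_mul_inner]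
  calc ∑ i, ‖v i‖ ^ 2 - ∑ i, ‖(v - w) i‖ ^ 2
      = ∑ a, (‖analysisMap v (b a)‖ ^ 2 - ‖analysisMap v (b a) - analysisMap w (b a)‖ ^ 2) := by
        simp only [← sum_norm_analysisMap_sq b, analysisMap_sub, LinearMap.sub_apply,
          Finset.sum_sub_distrib]
    _ ≤ ∑ a, inner ℝ (analysisMap v (b a)) (V.starProjection (analysisMap v (b a))) :=
        Finset.sum_le_sum fun a _ => real_inner_starProjection_ge V _ (hw ⟨b a, rfl⟩)
    _ = ∑ i, ∑ j, projMatrix V i j * Matrix.gram ℝ v i j := by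
        simp only [← sum_projMatrix_mul_mul, gram_eq, Finset.mul_sum]
        rw [Finset.sum_comm]
        exact Finset.sum_congr rfl fun i _ => Finset.sum_comm

end Value

section Certificate

open NormedSpace (normalize norm_normalize_eq_one_iff norm_smul_normalize)
open Module (finrank)

variable {ι E : Type*} [Fintype ι] [DecidableEq ι] [NormedAddCommGroup E] [InnerProductSpace ℝ E]

/-- The total deviation of the squared norms of the `x i` from the dimension, in relative terms. -/
noncomputable def normDeviation (x : ι → E) : ℝ :=
  ∑ i, (1 - ‖x i‖ ^ 2 / finrank ℝ E) ^ 2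

/-- The families of vectors that behave like a typical family of Gaussian vectors: nonzero, with
pairwise squared cosines at most `θ`, a small centered overlap matrix (as measured by `f`), and
squared norms close to the dimension (as measured by `κ`). -/
def goodRows (θ f κ : ℝ) : Set (ι → E) :=
  {x | (∀ i, x i ≠ 0) ∧
    (∀ i j, i ≠ j → inner ℝ (normalize (x i)) (normalize (x j)) ^ 2 ≤ θ) ∧
    sqOffDiag (centeredSq fun i => normalize (x i)) ≤ f ^ 2 ∧
    normDeviation x ≤ κ * Fintype.card ι}

/-- The smallness conditions under which `n` good rows in dimension `d` yield a pseudomoment matrix: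
`η` is the slack of the degree-4 part of the quartic kernel and `τ` the weight of the identity that
is mixed into the Gram matrix. -/
structure AdmissibleParameters (n d : ℕ) (θ f η τ : ℝ) : Prop where
  f_nonneg : 0 ≤ f
  η_pos : 0 < η
  η_le_one : η ≤ 1
  η_le_τ : η ≤ τ
  inv_dim_le : (d : ℝ)⁻¹ ≤ θ
  overlap_le : 2 * θ + 2 * n * θ ^ 2 + 4 * η * n * θ ≤ τ ^ 2
  trace_le : (1 + 3 / η) * (n / (d : ℝ) ^ 2) ≤ η / 2
  spectral_le : n * θ ^ 2 + f ≤ (η / 3) ^ 2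

omit [DecidableEq ι] in
lemma sum_norm_normalize_sub_smul_sq_le {x : ι → E} (hx : ∀ i, x i ≠ 0) :
    ∑ i, ‖normalize (x i) - (√(finrank ℝ E : ℝ))⁻¹ • x i‖ ^ 2 ≤ normDeviation x := by
  refine Finset.sum_le_sum fun i _ => ?_
  set s := √(finrank ℝ E : ℝ) with s_def
  set t := ‖x i‖ / s with t_def
  have t_nonneg : 0 ≤ t := by positivity
  have t_sq : t ^ 2 = ‖x i‖ ^ 2 / finrank ℝ E := by
    rw [t_def, div_pow, s_def, Real.sq_sqrt (Nat.cast_nonneg _)]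
  have diff_eq : normalize (x i) - s⁻¹ • x i = (1 - t) • normalize (x i) := by
    nth_rw 2 [← norm_smul_normalize (x i)]
    rw [smul_smul, sub_smul, one_smul, t_def, div_eq_inv_mul]
  calc ‖normalize (x i) - s⁻¹ • x i‖ ^ 2 = (1 - t) ^ 2 := by
        rw [diff_eq, norm_smul, norm_normalize_eq_one_iff.2 (hx i), mul_one, Real.norm_eq_abs,
          sq_abs]
    _ ≤ (1 - t) ^ 2 * (1 + t) ^ 2 :=
        le_mul_of_one_le_right (sq_nonneg _) (one_le_pow₀ (by linarith))
    _ = (1 - ‖x i‖ ^ 2 / finrank ℝ E) ^ 2 := by rw [← t_sq]; ring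

lemma sosValue_pseudomoment {n : ℕ} {X : Matrix (Fin n) (Fin n) ℝ} (hX : X.IsSymm)
    (hdiag : ∀ i, X i i = 1) (η ρ : ℝ) (A : Matrix (Fin n) (Fin n) ℝ) :
    sosValue A (Matrix.of fun S T : SmallSet n => pseudomoment X η ρ (symmDiff S.1 T.1)) =
      ρ * (∑ i, ∑ j, A i j * X i j) + (1 - ρ) * ∑ i, A i i := by
  simp only [sosValue, SmallSet.single, Matrix.of_apply, pseudomoment_symmDiff_singleton hX hdiag,
    Matrix.add_apply, Matrix.smul_apply, smul_eq_mul, mul_add, mul_left_comm _ ρ,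
    mul_left_comm _ (1 - ρ), Finset.sum_add_distrib, ← Finset.mul_sum]
  simp [Matrix.one_apply]

omit [Fintype ι] [DecidableEq ι] in
lemma gram_normalize_self {x : ι → E} (hx : ∀ i, x i ≠ 0) (i : ι) :
    Matrix.gram ℝ (fun i => normalize (x i)) i i = 1 := by
  rw [Matrix.gram_apply, real_inner_self_eq_norm_sq, norm_normalize_eq_one_iff.2 (hx i), one_pow]

variable [FiniteDimensional ℝ E] {n : ℕ} {x : Fin n → E} {θ f η τ κ : ℝ}

lemma isSoS4_of_mem_goodRows [NeZero n] (hpar : AdmissibleParameters n (finrank ℝ E) θ f η τ)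
    (hx : x ∈ goodRows θ f κ) :
    IsSoS4 (Matrix.of fun S T : SmallSet n => pseudomoment
      (Matrix.gram ℝ fun i => normalize (x i)) η (1 + τ)⁻¹ (symmDiff S.1 T.1)) := by
  obtain ⟨ne_zero, corr_le, offDiag_le, -⟩ := hx
  have : Nontrivial E := ⟨x 0, 0, ne_zero 0⟩
  have unit (i : Fin n) : ‖normalize (x i)‖ = 1 := norm_normalize_eq_one_iff.2 (ne_zero i)
  refine isSoS4_pseudomoment (Matrix.posSemidef_gram ℝ _)
    (gram_normalize_self ne_zero)
    hpar.η_pos.le hpar.η_le_τ ((inv_nonneg.2 (Nat.cast_nonneg _)).trans hpar.inv_dim_le)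
    corr_le hpar.overlap_le ?_
  refine posSemidef_quarticGap_gram unit hpar.η_pos hpar.η_le_one ?_ ?_
  · simpa using hpar.trace_le
  · exact norm_centeredSq_le hpar.η_pos.le hpar.f_nonneg hpar.inv_dim_le corr_le offDiag_le
      (by simpa using hpar.spectral_le)

lemma sum_projMatrix_mul_gram_normalize_ge (hx : x ∈ goodRows θ f κ)
    {V : Submodule ℝ (EuclideanSpace ℝ (Fin n))} (hV : LinearMap.range (analysisMap x) ≤ V) :
    n * (1 - κ) ≤
      ∑ i, ∑ j, projMatrix V i j * Matrix.gram ℝ (fun i => normalize (x i)) i j := by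
  obtain ⟨ne_zero, -, -, deviation_le⟩ := hx
  set s := (√(finrank ℝ E : ℝ))⁻¹
  have range_le : LinearMap.range (analysisMap (s • x)) ≤ V := by
    rintro _ ⟨e, rfl⟩
    rw [analysisMap_smul]
    exact V.smul_mem s (hV ⟨e, rfl⟩)
  have sum_unit : ∑ i, ‖normalize (x i)‖ ^ 2 = n := by
    simp [norm_normalize_eq_one_iff.2 (ne_zero _)]
  have value_ge := sum_projMatrix_mul_gram_ge V (fun i => normalize (x i)) (s • x) range_le
  have dist_le := sum_norm_normalize_sub_smul_sq_le ne_zero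
  rw [Fintype.card_fin] at deviation_le
  simp only [Pi.smul_apply] at value_ge
  linarith

theorem exists_isSoS4_of_mem_goodRows [NeZero n]
    (hpar : AdmissibleParameters n (finrank ℝ E) θ f η τ) (hx : x ∈ goodRows θ f κ)
    {V : Submodule ℝ (EuclideanSpace ℝ (Fin n))} (hV : LinearMap.range (analysisMap x) ≤ V) :
    ∃ M : Matrix (SmallSet n) (SmallSet n) ℝ,
      IsSoS4 M ∧ (1 + τ)⁻¹ * (1 - κ) ≤ (1 / (n : ℝ)) * sosValue (projMatrix V) M := by
  refine ⟨_, isSoS4_of_mem_goodRows hpar hx, ?_⟩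
  have n_pos : (0 : ℝ) < n := Nat.cast_pos.2 (NeZero.pos n)
  have τ_nonneg : 0 ≤ τ := hpar.η_pos.le.trans hpar.η_le_τ
  have diag_nonneg : 0 ≤ (1 - (1 + τ)⁻¹) * ∑ i, projMatrix V i i :=
    mul_nonneg (sub_nonneg.2 (inv_le_one_of_one_le₀ (by linarith)))
      (Finset.sum_nonneg fun i _ => projMatrix_diag_nonneg V i)
  rw [sosValue_pseudomoment (Matrix.isHermitian_iff_isSymm.1 (Matrix.isHermitian_gram ℝ _))
    (gram_normalize_self hx.1), one_div, le_inv_mul_iff₀ n_pos, mul_left_comm]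
  have gram_ge := mul_le_mul_of_nonneg_left (sum_projMatrix_mul_gram_normalize_ge hx hV)
    (inv_nonneg.2 (by linarith : 0 ≤ 1 + τ))
  linarith

end Certificate

section SphereMoments

open MeasureTheory ProbabilityTheory Module
open NormedSpace (normalize)

variable {E : Type*} [NormedAddCommGroup E] [InnerProductSpace ℝ E] [MeasurableSpace E]

/-- `ν` is the law of a uniformly random unit vector: it is carried by the unit sphere and invariant
under linear isometries. -/
structure IsUniformOnSphere (ν : Measure E) : Prop where
  ae_norm_eq_one : ∀ᵐ u ∂ν, ‖u‖ = 1
  map_eq (U : E ≃ₗᵢ[ℝ] E) : ν.map U = ν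

lemma integrable_of_continuous_of_ae_mem_isCompact {X : Type*} [TopologicalSpace X] [T2Space X]
    [MeasurableSpace X] [BorelSpace X] {μ : Measure X} [IsFiniteMeasure μ] {K : Set X}
    (hK : IsCompact K) (hμ : ∀ᵐ x ∂μ, x ∈ K) {f : X → ℝ} (hf : Continuous f) : Integrable f μ := by
  rw [← Measure.restrict_eq_self_of_ae_mem hμ]
  exact hf.continuousOn.integrableOn_compact hK

variable [BorelSpace E] {ν : Measure E}

lemma integral_inner_pow_of_map_eq (hν : ∀ U : E ≃ₗᵢ[ℝ] E, ν.map U = ν) {e : E} (he : ‖e‖ = 1)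
    (k : ℕ) (a : E) : ∫ u, inner ℝ u a ^ k ∂ν = ‖a‖ ^ k * ∫ u, inner ℝ u e ^ k ∂ν := by
  let U : E ≃ₗᵢ[ℝ] E := (ℝ ∙ (a - ‖a‖ • e))ᗮ.reflection
  have U_apply : U a = ‖a‖ • e :=
    Submodule.reflection_sub (by rw [norm_smul, norm_norm, he, mul_one])
  calc ∫ u, inner ℝ u a ^ k ∂ν = ∫ u, inner ℝ (U u) (U a) ^ k ∂ν := by simp only [U.inner_map_map]
    _ = ∫ u, inner ℝ u (U a) ^ k ∂(ν.map U) :=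
        (integral_map_equiv U.toHomeomorph.toMeasurableEquiv fun u => inner ℝ u (U a) ^ k).symm
    _ = ‖a‖ ^ k * ∫ u, inner ℝ u e ^ k ∂ν := by
        simp only [hν, U_apply, real_inner_smul_right, mul_pow, integral_const_mul]

omit [BorelSpace E] in
lemma integral_inner_sq_mul_inner_sq_of_pow_four {c : ℝ}
    (hint : ∀ a, Integrable (fun u => inner ℝ u a ^ 4) ν)
    (hc : ∀ a, ∫ u, inner ℝ u a ^ 4 ∂ν = c * ‖a‖ ^ 4) (a b : E) :
    ∫ u, inner ℝ u a ^ 2 * inner ℝ u b ^ 2 ∂ν =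
      c / 3 * (‖a‖ ^ 2 * ‖b‖ ^ 2 + 2 * inner ℝ a b ^ 2) := by
  have polarization (u : E) : inner ℝ u a ^ 2 * inner ℝ u b ^ 2 =
      1 / 12 * (inner ℝ u (a + b) ^ 4 + inner ℝ u (a - b) ^ 4
        - (2 * inner ℝ u a ^ 4 + 2 * inner ℝ u b ^ 4)) := by
    rw [inner_add_right, inner_sub_right]; ring
  simp only [polarization]
  rw [integral_const_mul,
    integral_sub ((hint _).fun_add (hint _))
      (((hint _).const_mul _).fun_add ((hint _).const_mul _)),
    integral_add (hint _) (hint _), integral_add ((hint _).const_mul _) ((hint _).const_mul _),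
    integral_const_mul, integral_const_mul, hc, hc, hc, hc, pow_mul ‖a + b‖ 2 2,
    pow_mul ‖a - b‖ 2 2, norm_add_sq_real, norm_sub_sq_real]
  ring

variable [FiniteDimensional ℝ E] [IsProbabilityMeasure ν]

namespace IsUniformOnSphere

lemma integrable_of_continuous (hν : IsUniformOnSphere ν) {f : E → ℝ} (hf : Continuous f) :
    Integrable f ν :=
  integrable_of_continuous_of_ae_mem_isCompact (isCompact_sphere 0 1)
    (hν.ae_norm_eq_one.mono fun _ hu => mem_sphere_zero_iff_norm.2 hu) hf

variable [Nontrivial E]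

lemma integral_inner_sq (hν : IsUniformOnSphere ν) (a : E) :
    ∫ u, inner ℝ u a ^ 2 ∂ν = ‖a‖ ^ 2 / finrank ℝ E := by
  set b := stdOrthonormalBasis ℝ E
  obtain ⟨e, he⟩ := exists_norm_eq E zero_le_one
  have moment := integral_inner_pow_of_map_eq hν.map_eq he 2
  have sum_eq_one : ∫ u, ∑ i, inner ℝ u (b i) ^ 2 ∂ν = 1 := by
    have : ∀ᵐ u ∂ν, ∑ i, inner ℝ u (b i) ^ 2 = 1 := by
      filter_upwards [hν.ae_norm_eq_one] with u hu
      rw [b.sum_sq_inner_left, hu, one_pow]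
    rw [integral_congr_ae this, integral_const, probReal_univ, one_smul]
  rw [integral_finsetSum _ fun i _ => hν.integrable_of_continuous (by fun_prop)] at sum_eq_one
  simp only [moment (b _), b.norm_eq_one, one_pow, one_mul, Finset.sum_const, Finset.card_univ,
    Fintype.card_fin, nsmul_eq_mul] at sum_eq_one
  rw [moment a, eq_div_iff (Nat.cast_ne_zero.2 finrank_pos.ne')]
  linear_combination ‖a‖ ^ 2 * sum_eq_one

lemma integral_inner_sq_mul_inner_sq (hν : IsUniformOnSphere ν) (a b : E) :
    ∫ u, inner ℝ u a ^ 2 * inner ℝ u b ^ 2 ∂ν =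
      (‖a‖ ^ 2 * ‖b‖ ^ 2 + 2 * inner ℝ a b ^ 2) / (finrank ℝ E * (finrank ℝ E + 2)) := by
  set β := stdOrthonormalBasis ℝ E
  obtain ⟨e, he⟩ := exists_norm_eq E zero_le_one
  set c := ∫ u, inner ℝ u e ^ 4 ∂ν
  have mixed_moment := integral_inner_sq_mul_inner_sq_of_pow_four
    (fun a => hν.integrable_of_continuous (by fun_prop))
    (fun a => (integral_inner_pow_of_map_eq hν.map_eq he 4 a).trans (mul_comm _ c))
  have sum_eq_one : ∑ i, ∑ j, ∫ u, inner ℝ u (β i) ^ 2 * inner ℝ u (β j) ^ 2 ∂ν = 1 := by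
    have integrable (i j) : Integrable (fun u => inner ℝ u (β i) ^ 2 * inner ℝ u (β j) ^ 2) ν :=
      hν.integrable_of_continuous (by fun_prop)
    simp only [← integral_finsetSum _ fun j _ => integrable _ j]
    rw [← integral_finsetSum _ fun i _ => integrable_finsetSum _ fun j _ => integrable i j]
    have : ∀ᵐ u ∂ν, ∑ i, ∑ j, inner ℝ u (β i) ^ 2 * inner ℝ u (β j) ^ 2 = 1 := by
      filter_upwards [hν.ae_norm_eq_one] with u hu
      rw [← Finset.sum_mul_sum, β.sum_sq_inner_left, hu, one_pow, one_mul]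
    rw [integral_congr_ae this, integral_const, probReal_univ, one_smul]
  simp only [mixed_moment, β.norm_eq_one, orthonormal_iff_ite.1 β.orthonormal, ite_pow, one_pow,
    zero_pow two_ne_zero, ← Finset.mul_sum, Finset.sum_add_distrib, Finset.sum_ite_eq,
    Finset.mem_univ, if_true, Finset.sum_const, Finset.card_univ, Fintype.card_fin, nsmul_eq_mul,
    mul_one] at sum_eq_one
  rw [mixed_moment, eq_div_iff (by have := finrank_pos (R := ℝ) (M := E); positivity)]
  linear_combination (‖a‖ ^ 2 * ‖b‖ ^ 2 + 2 * inner ℝ a b ^ 2) * sum_eq_one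

end IsUniformOnSphere

end SphereMoments

section GaussianNorm

open MeasureTheory ProbabilityTheory Module

variable {E : Type*} [NormedAddCommGroup E] [InnerProductSpace ℝ E] [FiniteDimensional ℝ E]
  [MeasurableSpace E] [BorelSpace E]

lemma map_inner_stdGaussian {e : E} (he : ‖e‖ = 1) :
    (stdGaussian E).map (fun g => inner ℝ g e) = gaussianReal 0 1 := by
  have hmap := IsGaussian.map_eq_gaussianReal (μ := stdGaussian E) (innerSL ℝ e)
  rw [integral_strongDual_stdGaussian, variance_dual_stdGaussian, innerSL_apply_norm, he,
    one_pow, Real.toNNReal_one] at hmap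
  simpa only [real_inner_comm e] using! hmap

lemma integral_inner_pow_stdGaussian {e : E} (he : ‖e‖ = 1) (k : ℕ) :
    ∫ g, inner ℝ g e ^ k ∂(stdGaussian E) = ∫ x, x ^ k ∂(gaussianReal 0 1) := by
  rw [← map_inner_stdGaussian he, integral_map (by fun_prop) (by fun_prop)]

lemma integrable_norm_pow_stdGaussian (k : ℕ) :
    Integrable (fun g => ‖g‖ ^ k) (stdGaussian E) :=
  (IsGaussian.memLp_id (stdGaussian E) k (ENNReal.natCast_ne_top k)).integrable_norm_pow'

lemma integral_gaussianReal_sq : ∫ x, x ^ 2 ∂(gaussianReal 0 1) = 1 := by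
  have variance_eq := variance_fun_id_gaussianReal (μ := 0) (v := 1)
  rwa [variance_of_integral_eq_zero (by fun_prop) (by simp), NNReal.coe_one] at variance_eq

lemma integral_norm_sq_stdGaussian : ∫ g, ‖g‖ ^ 2 ∂(stdGaussian E) = finrank ℝ E := by
  set b := stdOrthonormalBasis ℝ E
  have integrable (i) : Integrable (fun g => inner ℝ g (b i) ^ 2) (stdGaussian E) := by
    refine (integrable_norm_pow_stdGaussian 2).mono' (by fun_prop) (.of_forall fun g => ?_)
    rw [norm_pow]
    gcongr
    simpa using norm_inner_le_norm (𝕜 := ℝ) g (b i)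
  simp only [← b.sum_sq_inner_left]
  rw [integral_finsetSum _ fun i _ => integrable i]
  simp only [integral_inner_pow_stdGaussian (b.norm_eq_one _), integral_gaussianReal_sq,
    Finset.sum_const, Finset.card_univ, Fintype.card_fin, nsmul_one]

lemma variance_norm_sq_stdGaussian :
    Var[fun g => ‖g‖ ^ 2; stdGaussian E] =
      finrank ℝ E * Var[fun x => x ^ 2; gaussianReal 0 1] := by
  set b := stdOrthonormalBasis ℝ E
  have norm_sq_eq : (fun g : E => ‖g‖ ^ 2) ∘ (fun x : Fin (finrank ℝ E) → ℝ => ∑ i, x i • b i) =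
      ∑ i, fun x => x i ^ 2 := by
    ext x
    simp [← b.sum_sq_inner_right, inner_sum, real_inner_smul_right,
      orthonormal_iff_ite.1 b.orthonormal]
  have memLp : MemLp (fun x => x ^ 2) 2 (gaussianReal 0 1) := by
    rw [memLp_two_iff_integrable_sq (by fun_prop)]
    simpa [← pow_mul, (show Even 4 by decide).pow_abs] using
      (IsGaussian.memLp_id (gaussianReal 0 1) 4 (by simp)).integrable_norm_pow (by simp)
  rw [stdGaussian_eq_map_pi_orthonormalBasis b, variance_map (by fun_prop)
    (Measurable.aemeasurable (by fun_prop)), norm_sq_eq, variance_sum_pi fun _ => memLp,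
    Finset.sum_const, Finset.card_univ, Fintype.card_fin, nsmul_eq_mul]

lemma integral_norm_sq_deviation_stdGaussian [Nontrivial E] :
    ∫ g, (1 - ‖g‖ ^ 2 / finrank ℝ E) ^ 2 ∂(stdGaussian E) =
      Var[fun x => x ^ 2; gaussianReal 0 1] / finrank ℝ E := by
  have dim_ne_zero : (finrank ℝ E : ℝ) ≠ 0 := Nat.cast_ne_zero.2 finrank_pos.ne'
  have integral_eq := variance_norm_sq_stdGaussian (E := E)
  rw [variance_eq_integral (by fun_prop), integral_norm_sq_stdGaussian] at integral_eq
  have rescale (g : E) : (1 - ‖g‖ ^ 2 / finrank ℝ E) ^ 2 =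
      (‖g‖ ^ 2 - finrank ℝ E) ^ 2 * ((finrank ℝ E : ℝ) ^ 2)⁻¹ := by
    field_simp; ring
  simp only [rescale]
  rw [integral_mul_const, integral_eq]
  field_simp

@[fun_prop]
lemma measurable_normalize : Measurable (NormedSpace.normalize : E → E) := by
  unfold NormedSpace.normalize
  fun_prop

variable [Nontrivial E]

lemma ae_ne_zero_stdGaussian : ∀ᵐ g ∂(stdGaussian E), g ≠ 0 := by
  obtain ⟨e, he⟩ := exists_norm_eq E zero_le_one
  have := nullSingletonClass_gaussianReal (μ := 0) (v := 1) one_ne_zero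
  have coordinate_ne_zero : ∀ᵐ x ∂((stdGaussian E).map fun g => inner ℝ g e), x ≠ 0 := by
    rw [map_inner_stdGaussian he]
    simp [ae_iff]
  filter_upwards [ae_of_ae_map (by fun_prop) coordinate_ne_zero] with g hg hg0
  exact hg (by rw [hg0, inner_zero_left])

lemma isUniformOnSphere_map_normalize :
    IsUniformOnSphere ((stdGaussian E).map (NormedSpace.normalize : E → E)) where
  ae_norm_eq_one := by
    rw [ae_map_iff measurable_normalize.aemeasurable (by measurability)]
    exact ae_ne_zero_stdGaussian.mono fun g hg => NormedSpace.norm_normalize_eq_one_iff.2 hg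
  map_eq U := by
    have comm : U ∘ (NormedSpace.normalize : E → E) =
        NormedSpace.normalize ∘ U := by
      ext g
      simp [NormedSpace.normalize]
    rw [Measure.map_map (by fun_prop) (by fun_prop), comm,
      ← Measure.map_map (by fun_prop) (by fun_prop), stdGaussian_map]

end GaussianNorm

section Resampling

open MeasureTheory

lemma measurePreserving_update_pi {ι : Type*} {α : ι → Type*} [Fintype ι] [DecidableEq ι]
    [∀ i, MeasurableSpace (α i)] (μ : ∀ i, Measure (α i)) [∀ i, IsProbabilityMeasure (μ i)]
    (j : ι) :
    MeasurePreserving (fun z : (∀ i, α i) × α j => Function.update z.1 j z.2)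
      ((Measure.pi μ).prod (μ j)) (Measure.pi μ) := by
  have measurable : Measurable (fun z : (∀ i, α i) × α j => Function.update z.1 j z.2) := by
    refine measurable_pi_iff.2 fun i => ?_
    obtain rfl | hij := eq_or_ne i j
    · simpa only [Function.update_self] using measurable_snd
    · simpa only [Function.update_of_ne hij] using measurable_fst.eval
  refine ⟨measurable, (Measure.pi_eq fun s hs => ?_).symm⟩
  have preimage_eq : (fun z : (∀ i, α i) × α j => Function.update z.1 j z.2) ⁻¹' (Set.univ.pi s) =
      (Set.univ.pi (Function.update s j Set.univ)) ×ˢ s j := by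
    ext z
    simp only [Set.mem_preimage, Set.mem_univ_pi, Set.mem_prod]
    refine ⟨fun h => ⟨fun i => ?_, by simpa using h j⟩, fun ⟨h₁, h₂⟩ i => ?_⟩ <;>
      obtain rfl | hij := eq_or_ne i j
    · simp
    · simpa [Function.update_of_ne hij] using h i
    · simpa using h₂
    · simpa [Function.update_of_ne hij] using h₁ i
  rw [Measure.map_apply measurable (MeasurableSet.univ_pi hs), preimage_eq, Measure.prod_prod,
    Measure.pi_pi, ← Finset.mul_prod_erase _ _ (Finset.mem_univ j),
    ← Finset.mul_prod_erase _ (fun i => μ i (s i)) (Finset.mem_univ j), Function.update_self,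
    measure_univ, one_mul, mul_comm]
  congr 1
  exact Finset.prod_congr rfl fun i hi => by rw [Function.update_of_ne (Finset.ne_of_mem_erase hi)]

lemma integral_pi_eq_integral_integral_update {ι : Type*} {α : ι → Type*} [Fintype ι]
    [DecidableEq ι] [∀ i, MeasurableSpace (α i)] {μ : ∀ i, Measure (α i)}
    [∀ i, IsProbabilityMeasure (μ i)] (j : ι) {F : (∀ i, α i) → ℝ}
    (hF : Integrable F (Measure.pi μ)) :
    ∫ x, F x ∂(Measure.pi μ) = ∫ x, ∫ y, F (Function.update x j y) ∂(μ j) ∂(Measure.pi μ) := by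
  have hupdate := measurePreserving_update_pi μ j
  conv_lhs => rw [← hupdate.map_eq]
  rw [integral_map hupdate.measurable.aemeasurable
    (hupdate.map_eq.symm ▸ hF.aestronglyMeasurable)]
  exact integral_prod _ (hupdate.integrable_comp_of_integrable hF)

end Resampling

section SphereOverlaps

open MeasureTheory ProbabilityTheory Module

variable {E : Type*} [NormedAddCommGroup E] [InnerProductSpace ℝ E]

/-- The squared correlation of two vectors, centered so that it has mean zero when one of them is a
uniformly random unit vector and the other one a fixed unit vector. -/
noncomputable def centeredOverlap (a b : E) : ℝ :=
  inner ℝ a b ^ 2 - (finrank ℝ E : ℝ)⁻¹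

lemma centeredOverlap_comm (a b : E) : centeredOverlap a b = centeredOverlap b a := by
  rw [centeredOverlap, centeredOverlap, real_inner_comm]

lemma centeredSq_apply_of_ne {ι : Type*} [DecidableEq ι] (v : ι → E) {i j : ι} (hij : i ≠ j) :
    centeredSq v i j = centeredOverlap (v i) (v j) := by
  rw [centeredSq, Matrix.of_apply, if_neg hij, centeredOverlap]

@[fun_prop]
lemma continuous_centeredOverlap {X : Type*} [TopologicalSpace X] {f g : X → E}
    (hf : Continuous f) (hg : Continuous g) :
    Continuous fun x => centeredOverlap (f x) (g x) :=
  ((hf.inner hg).pow 2).sub continuous_const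

variable (E) in
/-- The variance scale `2 / (D (D + 2))` of `centeredOverlap` in dimension `D`. -/
noncomputable def overlapVariance : ℝ :=
  2 / (finrank ℝ E * (finrank ℝ E + 2))

lemma overlapVariance_nonneg : 0 ≤ overlapVariance E := by
  rw [overlapVariance]; positivity

variable [MeasurableSpace E] {ν : Measure E} [IsProbabilityMeasure ν] {ι : Type*} [Fintype ι]

namespace IsUniformOnSphere

lemma ae_pi_norm_eq_one (hν : IsUniformOnSphere ν) :
    ∀ᵐ x ∂(Measure.pi fun _ : ι => ν), ∀ i, ‖x i‖ = 1 :=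
  ae_all_iff.2 fun i =>
    (measurePreserving_eval (fun _ => ν) i).quasiMeasurePreserving.ae hν.ae_norm_eq_one

variable [FiniteDimensional ℝ E] [BorelSpace E]

lemma integrable_pi_of_continuous (hν : IsUniformOnSphere ν) {F : (ι → E) → ℝ}
    (hF : Continuous F) : Integrable F (Measure.pi fun _ : ι => ν) :=
  integrable_of_continuous_of_ae_mem_isCompact
    (isCompact_univ_pi fun _ : ι => isCompact_sphere (0 : E) 1)
    (hν.ae_pi_norm_eq_one.mono fun _ hx i _ => mem_sphere_zero_iff_norm.2 (hx i)) hF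

variable [Nontrivial E]

lemma integral_centeredOverlap_mul (hν : IsUniformOnSphere ν) {a b : E} (ha : ‖a‖ = 1)
    (hb : ‖b‖ = 1) :
    ∫ u, centeredOverlap u a * centeredOverlap u b ∂ν =
      overlapVariance E * centeredOverlap a b := by
  have expand (u : E) : centeredOverlap u a * centeredOverlap u b =
      inner ℝ u a ^ 2 * inner ℝ u b ^ 2 - (finrank ℝ E : ℝ)⁻¹ * inner ℝ u a ^ 2
        - ((finrank ℝ E : ℝ)⁻¹ * inner ℝ u b ^ 2 - (finrank ℝ E : ℝ)⁻¹ ^ 2) := by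
    rw [centeredOverlap, centeredOverlap]; ring
  simp only [expand]
  rw [integral_sub, integral_sub, integral_sub, integral_const_mul, integral_const_mul,
    integral_const, probReal_univ, hν.integral_inner_sq, hν.integral_inner_sq,
    hν.integral_inner_sq_mul_inner_sq, ha, hb, overlapVariance, centeredOverlap]
  · have : (finrank ℝ E : ℝ) ≠ 0 := Nat.cast_ne_zero.2 finrank_pos.ne'
    simp only [smul_eq_mul]
    field_simp
    ring
  all_goals exact hν.integrable_of_continuous (by fun_prop)

/-- Fubini against an independent standard Gaussian `h`: the moment `∫ ⟪u, h⟫ ^ (2 * p)` is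
Gaussian for fixed `u`, and equals `‖h‖ ^ (2 * p)` times the moment of `u` for fixed `h`. -/
lemma integral_inner_pow_le (hν : IsUniformOnSphere ν) {a : E} (ha : ‖a‖ = 1) (p : ℕ) :
    ∫ u, inner ℝ u a ^ (2 * p) ∂ν ≤
      (∫ x, x ^ (2 * p) ∂(gaussianReal 0 1)) / (finrank ℝ E : ℝ) ^ p := by
  set γ := stdGaussian E
  set K := ∫ x, x ^ (2 * p) ∂(gaussianReal 0 1)
  set m := ∫ u, inner ℝ u a ^ (2 * p) ∂ν
  have integrable : Integrable (Function.uncurry fun u h => inner ℝ u h ^ (2 * p)) (ν.prod γ) := by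
    refine ((integrable_norm_pow_stdGaussian (2 * p)).comp_snd ν).mono'
      (by unfold Function.uncurry; fun_prop) ?_
    filter_upwards [Measure.quasiMeasurePreserving_fst.ae hν.ae_norm_eq_one] with z hz
    rw [Function.uncurry, norm_pow]
    gcongr
    simpa [hz] using norm_inner_le_norm (𝕜 := ℝ) z.1 z.2
  have inner_integral_left : ∀ᵐ u ∂ν, ∫ h, inner ℝ u h ^ (2 * p) ∂γ = K := by
    filter_upwards [hν.ae_norm_eq_one] with u hu
    simpa only [real_inner_comm] using integral_inner_pow_stdGaussian hu (2 * p)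
  have jensen : (finrank ℝ E : ℝ) ^ p ≤ ∫ h, ‖h‖ ^ (2 * p) ∂γ := by
    rw [← integral_norm_sq_stdGaussian]
    simpa only [← pow_mul] using
      (convexOn_pow p).map_integral_le (μ := γ) (f := fun h => ‖h‖ ^ 2)
        (continuous_pow p).continuousOn isClosed_Ici (.of_forall fun h => sq_nonneg ‖h‖)
        (integrable_norm_pow_stdGaussian 2)
        (by simpa only [Function.comp_def, ← pow_mul] using integrable_norm_pow_stdGaussian (2 * p))
  have fubini : K = (∫ h, ‖h‖ ^ (2 * p) ∂γ) * m := by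
    have swap := integral_integral_swap integrable
    rwa [integral_congr_ae inner_integral_left, integral_const, probReal_univ, one_smul,
      funext (integral_inner_pow_of_map_eq hν.map_eq ha (2 * p)), integral_mul_const] at swap
  rw [le_div_iff₀ (pow_pos (Nat.cast_pos.2 finrank_pos) p), fubini, mul_comm]
  exact mul_le_mul_of_nonneg_right jensen
    (integral_nonneg fun u => (even_two_mul p).pow_nonneg _)

lemma integral_centeredOverlap_mul_rows [DecidableEq ι] (hν : IsUniformOnSphere ν) {i j k : ι}
    (hij : i ≠ j) (hik : i ≠ k) {G : (ι → E) → ℝ} (hG : Continuous G)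
    (hGi : ∀ x y, G (Function.update x i y) = G x) :
    ∫ x, centeredOverlap (x i) (x j) * centeredOverlap (x i) (x k) * G x
        ∂(Measure.pi fun _ : ι => ν) =
      overlapVariance E * ∫ x, centeredOverlap (x j) (x k) * G x ∂(Measure.pi fun _ : ι => ν) := by
  rw [integral_pi_eq_integral_integral_update i (hν.integrable_pi_of_continuous
    (F := fun x => centeredOverlap (x i) (x j) * centeredOverlap (x i) (x k) * G x) (by fun_prop))]
  simp only [Function.update_self, Function.update_of_ne hij.symm, Function.update_of_ne hik.symm,
    hGi, integral_mul_const]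
  rw [← integral_const_mul]
  refine integral_congr_ae ?_
  filter_upwards [hν.ae_pi_norm_eq_one] with x hx
  rw [hν.integral_centeredOverlap_mul (hx j) (hx k), mul_assoc]

lemma integral_centeredOverlap_sq_mul_rows_le [DecidableEq ι] (hν : IsUniformOnSphere ν)
    {i j : ι} (hij : i ≠ j) {G : (ι → E) → ℝ} (hG : Continuous G)
    (hGi : ∀ x y, G (Function.update x i y) = G x) (G_nonneg : ∀ x, 0 ≤ G x) :
    ∫ x, centeredOverlap (x i) (x j) ^ 2 * G x ∂(Measure.pi fun _ : ι => ν) ≤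
      overlapVariance E * ∫ x, G x ∂(Measure.pi fun _ : ι => ν) := by
  simp only [sq]
  rw [hν.integral_centeredOverlap_mul_rows hij hij hG hGi]
  refine mul_le_mul_of_nonneg_left (integral_mono_ae ?_ (hν.integrable_pi_of_continuous hG) ?_)
    overlapVariance_nonneg
  · exact hν.integrable_pi_of_continuous (by fun_prop)
  · filter_upwards [hν.ae_pi_norm_eq_one] with x hx
    refine mul_le_of_le_one_left (G_nonneg x) ?_
    rw [centeredOverlap, real_inner_self_eq_norm_sq, hx]
    simp

lemma integral_centeredOverlap_sq_le (hν : IsUniformOnSphere ν) {i j : ι} (hij : i ≠ j) :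
    ∫ x, centeredOverlap (x i) (x j) ^ 2 ∂(Measure.pi fun _ : ι => ν) ≤ overlapVariance E := by
  classical
  simpa using hν.integral_centeredOverlap_sq_mul_rows_le hij (G := 1) continuous_one
    (fun _ _ => rfl) fun _ => zero_le_one

lemma integral_centeredOverlap_path_le (hν : IsUniformOnSphere ν) {i j k : ι} (hij : i ≠ j)
    (hik : i ≠ k) (hjk : j ≠ k) :
    ∫ x, centeredOverlap (x i) (x j) ^ 2 * centeredOverlap (x j) (x k) ^ 2
        ∂(Measure.pi fun _ : ι => ν) ≤ overlapVariance E ^ 2 := by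
  classical
  calc _ ≤ overlapVariance E *
        ∫ x, centeredOverlap (x j) (x k) ^ 2 ∂(Measure.pi fun _ : ι => ν) :=
      hν.integral_centeredOverlap_sq_mul_rows_le hij
        (G := fun x => centeredOverlap (x j) (x k) ^ 2) (by fun_prop)
        (fun x y => by simp only [Function.update_of_ne hij.symm, Function.update_of_ne hik.symm])
        fun _ => sq_nonneg _
    _ ≤ overlapVariance E ^ 2 := by
      rw [sq]
      exact mul_le_mul_of_nonneg_left (hν.integral_centeredOverlap_sq_le hjk)
        overlapVariance_nonneg

lemma integral_centeredOverlap_cycle_le (hν : IsUniformOnSphere ν) {i j k l : ι} (hij : i ≠ j)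
    (hik : i ≠ k) (hil : i ≠ l) (hjk : j ≠ k) (hjl : j ≠ l) (hkl : k ≠ l) :
    ∫ x, centeredOverlap (x j) (x i) * centeredOverlap (x j) (x k) *
        (centeredOverlap (x l) (x i) * centeredOverlap (x l) (x k))
        ∂(Measure.pi fun _ : ι => ν) ≤ overlapVariance E ^ 3 := by
  classical
  rw [hν.integral_centeredOverlap_mul_rows hij.symm hjk
    (G := fun x => centeredOverlap (x l) (x i) * centeredOverlap (x l) (x k)) (by fun_prop)
    fun x y => by simp only [Function.update_of_ne hjl.symm, Function.update_of_ne hij,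
        Function.update_of_ne hjk.symm]]
  simp only [mul_comm (centeredOverlap (_ : E) _) (_ * _)]
  rw [hν.integral_centeredOverlap_mul_rows hil.symm hkl.symm
    (G := fun x => centeredOverlap (x i) (x k)) (by fun_prop) fun x y => by
      simp only [Function.update_of_ne hil, Function.update_of_ne hkl]]
  simp only [← sq]
  calc _ ≤ overlapVariance E * (overlapVariance E * overlapVariance E) := by
        gcongr
        · exact overlapVariance_nonneg
        · exact overlapVariance_nonneg
        · exact hν.integral_centeredOverlap_sq_le hik
    _ = overlapVariance E ^ 3 := by ring

end IsUniformOnSphere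

end SphereOverlaps

section RandomRows

open MeasureTheory ProbabilityTheory Module Finset

lemma measureReal_lt_le_div_of_integral_le {α : Type*} [MeasurableSpace α] {μ : Measure α}
    [IsFiniteMeasure μ] {F : α → ℝ} (hF : Integrable F μ) (F_nonneg : ∀ x, 0 ≤ F x) {c B : ℝ}
    (hc : 0 < c) (hB : ∫ x, F x ∂μ ≤ B) : μ.real {x | c < F x} ≤ B / c := by
  rw [le_div_iff₀ hc, mul_comm]
  calc c * μ.real {x | c < F x} ≤ c * μ.real {x | c ≤ F x} := by
        gcongr
        · finiteness
        · exact le_of_lt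
    _ ≤ ∫ x, F x ∂μ := mul_meas_ge_le_integral_of_nonneg (.of_forall F_nonneg) hF c
    _ ≤ B := hB

variable {E : Type*} [NormedAddCommGroup E] [InnerProductSpace ℝ E] {ι : Type*} [Fintype ι]

omit [Fintype ι] in
@[fun_prop]
lemma continuous_centeredSq [DecidableEq ι] :
    Continuous (centeredSq : (ι → E) → Matrix ι ι ℝ) := by
  refine continuous_matrix fun i j => ?_
  simp only [centeredSq, Matrix.of_apply]
  split_ifs <;> fun_prop

@[fun_prop]
lemma continuous_sqOffDiag : Continuous (sqOffDiag : Matrix ι ι ℝ → ℝ) := by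
  unfold sqOffDiag
  fun_prop

lemma card_offDiag_univ_le : ((univ : Finset ι).offDiag.card : ℝ) ≤ Fintype.card ι ^ 2 := by
  classical
  rw [offDiag_card, card_univ, sq]
  exact_mod_cast Nat.sub_le _ _

variable [FiniteDimensional ℝ E] [MeasurableSpace E] [BorelSpace E] [Nontrivial E] {ν : Measure E}
  [IsProbabilityMeasure ν]

namespace IsUniformOnSphere

lemma integral_inner_rows_pow_le (hν : IsUniformOnSphere ν) {i j : ι} (hij : i ≠ j) (p : ℕ) :
    ∫ v, inner ℝ (v i) (v j) ^ (2 * p) ∂(Measure.pi fun _ : ι => ν) ≤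
      (∫ x, x ^ (2 * p) ∂(gaussianReal 0 1)) / (finrank ℝ E : ℝ) ^ p := by
  classical
  set B := (∫ x, x ^ (2 * p) ∂(gaussianReal 0 1)) / (finrank ℝ E : ℝ) ^ p
  rw [integral_pi_eq_integral_integral_update i (hν.integrable_pi_of_continuous (by fun_prop))]
  simp only [Function.update_self, Function.update_of_ne hij.symm]
  calc _ ≤ ∫ _ : ι → E, B ∂(Measure.pi fun _ : ι => ν) := by
        refine integral_mono_of_nonneg (.of_forall fun v => integral_nonneg fun u =>
          (even_two_mul p).pow_nonneg _) (integrable_const _) ?_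
        filter_upwards [hν.ae_pi_norm_eq_one] with v hv
        exact hν.integral_inner_pow_le (hv j) p
    _ = B := by rw [integral_const, probReal_univ, one_smul]

lemma measureReal_exists_lt_inner_sq_le (hν : IsUniformOnSphere ν) {θ : ℝ}
    (hθ : 0 < θ) {p : ℕ} (hp : p ≠ 0) :
    (Measure.pi fun _ : ι => ν).real {v | ∃ i j, i ≠ j ∧ θ < inner ℝ (v i) (v j) ^ 2} ≤
      Fintype.card ι ^ 2 *
        ((∫ x, x ^ (2 * p) ∂(gaussianReal 0 1)) / (finrank ℝ E * θ) ^ p) := by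
  classical
  set B := (∫ x, x ^ (2 * p) ∂(gaussianReal 0 1)) / (finrank ℝ E * θ) ^ p with B_def
  have B_nonneg : 0 ≤ B :=
    div_nonneg (integral_nonneg fun x => (even_two_mul p).pow_nonneg x) (by positivity)
  have pair_le (q : ι × ι) (hq : q ∈ (univ : Finset ι).offDiag) :
      (Measure.pi fun _ : ι => ν).real {v | θ ^ p < inner ℝ (v q.1) (v q.2) ^ (2 * p)} ≤ B := by
    rw [B_def, mul_pow, ← div_div]
    exact measureReal_lt_le_div_of_integral_le (hν.integrable_pi_of_continuous (by fun_prop))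
      (fun v => (even_two_mul p).pow_nonneg _) (pow_pos hθ p)
      (hν.integral_inner_rows_pow_le (mem_offDiag.1 hq).2.2 p)
  have subset : {v : ι → E | ∃ i j, i ≠ j ∧ θ < inner ℝ (v i) (v j) ^ 2} ⊆
      ⋃ q ∈ (univ : Finset ι).offDiag, {v | θ ^ p < inner ℝ (v q.1) (v q.2) ^ (2 * p)} := by
    rintro v ⟨i, j, hij, hlt⟩
    refine Set.mem_biUnion (x := (i, j)) (by simpa using hij) ?_
    rw [Set.mem_ofPred_eq, pow_mul]
    exact pow_lt_pow_left₀ hlt hθ.le hp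
  calc _ ≤ ∑ q ∈ (univ : Finset ι).offDiag,
        (Measure.pi fun _ : ι => ν).real {v | θ ^ p < inner ℝ (v q.1) (v q.2) ^ (2 * p)} :=
        (measureReal_mono subset (measure_ne_top _ _)).trans (measureReal_biUnion_finset_le _ _)
    _ ≤ (univ : Finset ι).offDiag.card * B := by
        rw [← nsmul_eq_mul]
        exact sum_le_card_nsmul _ _ _ pair_le
    _ ≤ Fintype.card ι ^ 2 * B := by
        gcongr
        exact card_offDiag_univ_le

variable [DecidableEq ι]

lemma integral_centeredSq_path_mul_path_le (hν : IsUniformOnSphere ν) {i k : ι} (hik : i ≠ k)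
    (j l : ι) :
    ∫ v, centeredSq v i j * centeredSq v j k * (centeredSq v i l * centeredSq v l k)
        ∂(Measure.pi fun _ : ι => ν) ≤
      overlapVariance E ^ 3 + if j = l then overlapVariance E ^ 2 else 0 := by
  have σ_nonneg := overlapVariance_nonneg (E := E)
  have diag_eq_zero (v : ι → E) (m : ι) : centeredSq v m m = 0 := if_pos rfl
  have bound_nonneg : 0 ≤ overlapVariance E ^ 3 + if j = l then overlapVariance E ^ 2 else 0 := by
    positivity
  obtain rfl | hij := eq_or_ne i j
  · simpa only [diag_eq_zero, zero_mul, integral_zero] using bound_nonneg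
  obtain rfl | hil := eq_or_ne i l
  · simpa only [diag_eq_zero, zero_mul, mul_zero, integral_zero] using bound_nonneg
  obtain rfl | hjk := eq_or_ne j k
  · simpa only [diag_eq_zero, zero_mul, mul_zero, integral_zero] using bound_nonneg
  obtain rfl | hlk := eq_or_ne l k
  · simpa only [diag_eq_zero, mul_zero, integral_zero] using bound_nonneg
  simp only [centeredSq_apply_of_ne _ hij, centeredSq_apply_of_ne _ hjk,
    centeredSq_apply_of_ne _ hil, centeredSq_apply_of_ne _ hlk]
  obtain rfl | hjl := eq_or_ne j l
  · rw [if_pos rfl]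
    refine (le_of_eq ?_).trans ((hν.integral_centeredOverlap_path_le hij hik hjk).trans
      (le_add_of_nonneg_left (pow_nonneg σ_nonneg 3)))
    exact integral_congr_ae (.of_forall fun v => by ring)
  · rw [if_neg hjl, add_zero]
    simpa only [centeredOverlap_comm] using
      hν.integral_centeredOverlap_cycle_le hij hik hil hjk hjl hlk.symm

lemma integral_centeredSq_mul_self_apply_sq_le (hν : IsUniformOnSphere ν) {i k : ι}
    (hik : i ≠ k) :
    ∫ v, (centeredSq v * centeredSq v) i k ^ 2 ∂(Measure.pi fun _ : ι => ν) ≤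
      Fintype.card ι ^ 2 * overlapVariance E ^ 3 + Fintype.card ι * overlapVariance E ^ 2 := by
  have integrable (j l : ι) : Integrable (fun v : ι → E => centeredSq v i j * centeredSq v j k *
      (centeredSq v i l * centeredSq v l k)) (Measure.pi fun _ : ι => ν) :=
    hν.integrable_pi_of_continuous (by fun_prop)
  simp only [Matrix.mul_apply, sq (∑ _, _), sum_mul_sum]
  rw [integral_finsetSum _ fun j _ => integrable_finsetSum _ fun l _ => integrable j l]
  simp only [integral_finsetSum _ fun l _ => integrable _ l]
  calc _ ≤ ∑ j, ∑ l, (overlapVariance E ^ 3 + if j = l then overlapVariance E ^ 2 else 0) :=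
        sum_le_sum fun j _ => sum_le_sum fun l _ => hν.integral_centeredSq_path_mul_path_le hik j l
    _ = Fintype.card ι ^ 2 * overlapVariance E ^ 3 + Fintype.card ι * overlapVariance E ^ 2 := by
        simp only [sum_add_distrib, sum_const, card_univ, nsmul_eq_mul, sum_ite_eq, mem_univ,
          if_true]
        ring

lemma integral_sqOffDiag_centeredSq_le (hν : IsUniformOnSphere ν) :
    ∫ v, sqOffDiag (centeredSq v) ∂(Measure.pi fun _ : ι => ν) ≤
      Fintype.card ι ^ 2 *
        (Fintype.card ι ^ 2 * overlapVariance E ^ 3 + Fintype.card ι * overlapVariance E ^ 2) := by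
  have σ_nonneg := overlapVariance_nonneg (E := E)
  simp only [sqOffDiag]
  rw [integral_finsetSum _ fun q _ => hν.integrable_pi_of_continuous (by fun_prop)]
  refine (sum_le_card_nsmul _ _ _ fun q hq =>
    hν.integral_centeredSq_mul_self_apply_sq_le (mem_offDiag.1 hq).2.2).trans ?_
  rw [nsmul_eq_mul]
  gcongr
  exact card_offDiag_univ_le

lemma measureReal_lt_sqOffDiag_le (hν : IsUniformOnSphere ν) {f : ℝ} (hf : 0 < f) :
    (Measure.pi fun _ : ι => ν).real {v | f ^ 2 < sqOffDiag (centeredSq v)} ≤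
      Fintype.card ι ^ 2 * (Fintype.card ι ^ 2 * overlapVariance E ^ 3 +
        Fintype.card ι * overlapVariance E ^ 2) / f ^ 2 :=
  measureReal_lt_le_div_of_integral_le (hν.integrable_pi_of_continuous (by fun_prop))
    (fun v => sum_nonneg fun q _ => sq_nonneg _) (pow_pos hf 2) hν.integral_sqOffDiag_centeredSq_le

end IsUniformOnSphere

end RandomRows

section GaussianRows

open MeasureTheory ProbabilityTheory Module
open NormedSpace (normalize)

variable {E : Type*} [NormedAddCommGroup E] [InnerProductSpace ℝ E] [FiniteDimensional ℝ E]
  [MeasurableSpace E] [BorelSpace E] {ι : Type*} [Fintype ι]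

omit [FiniteDimensional ℝ E] [MeasurableSpace E] [BorelSpace E] in
@[fun_prop]
lemma continuous_normDeviation : Continuous (normDeviation : (ι → E) → ℝ) := by
  unfold normDeviation
  fun_prop

lemma measurableSet_goodRows [DecidableEq ι] (θ f κ : ℝ) :
    MeasurableSet (goodRows θ f κ : Set (ι → E)) := by
  have measurable_normalize_rows : Measurable fun (x : ι → E) i => normalize (x i) := by fun_prop
  refine .inter ?_ (.inter ?_ (.inter ?_ ?_))
  · exact measurableSet_setOfPred.2 (.forall fun i => measurableSet_setOfPred.1
      ((measurableSet_singleton 0).compl.preimage (measurable_pi_apply i)))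
  · refine measurableSet_setOfPred.2 (.forall fun i => .forall fun j => .imp measurable_const ?_)
    exact measurableSet_setOfPred.1 (measurableSet_le (by fun_prop) measurable_const)
  · exact measurableSet_le
      ((continuous_sqOffDiag.comp continuous_centeredSq).measurable.comp measurable_normalize_rows)
      measurable_const
  · exact measurableSet_le continuous_normDeviation.measurable measurable_const

lemma integrable_norm_sq_deviation_stdGaussian :
    Integrable (fun g : E => (1 - ‖g‖ ^ 2 / finrank ℝ E) ^ 2) (stdGaussian E) := by
  have expand (g : E) : (1 - ‖g‖ ^ 2 / finrank ℝ E) ^ 2 =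
      1 - 2 / finrank ℝ E * ‖g‖ ^ 2 + 1 / (finrank ℝ E : ℝ) ^ 2 * ‖g‖ ^ 4 := by ring
  simp only [expand]
  exact ((integrable_const _).sub ((integrable_norm_pow_stdGaussian 2).const_mul _)).add
    ((integrable_norm_pow_stdGaussian 4).const_mul _)

lemma measurePreserving_normalize_pi_stdGaussian :
    MeasurePreserving (fun (x : ι → E) i => normalize (x i))
      (Measure.pi fun _ : ι => stdGaussian E)
      (Measure.pi fun _ : ι => (stdGaussian E).map normalize) := by
  have : IsProbabilityMeasure ((stdGaussian E).map (normalize : E → E)) :=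
    Measure.isProbabilityMeasure_map (by fun_prop)
  exact measurePreserving_pi _ _ fun _ => ⟨by fun_prop, rfl⟩

lemma measureReal_preimage_normalize_le (s : Set (ι → E)) :
    (Measure.pi fun _ : ι => stdGaussian E).real ((fun x i => normalize (x i)) ⁻¹' s) ≤
      (Measure.pi fun _ : ι => (stdGaussian E).map NormedSpace.normalize).real s := by
  have : IsProbabilityMeasure ((stdGaussian E).map (normalize : E → E)) :=
    Measure.isProbabilityMeasure_map (by fun_prop)
  exact ENNReal.toReal_mono (measure_ne_top _ _)
    (measurePreserving_normalize_pi_stdGaussian.measure_preimage_le s)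

variable [Nontrivial E]

lemma measureReal_lt_normDeviation_le [Nonempty ι] {κ : ℝ} (hκ : 0 < κ) :
    (Measure.pi fun _ : ι => stdGaussian E).real {x | κ * Fintype.card ι < normDeviation x} ≤
      Var[fun x => x ^ 2; gaussianReal 0 1] / (finrank ℝ E * κ) := by
  have : (0 : ℝ) < Fintype.card ι := Nat.cast_pos.2 Fintype.card_pos
  have integrable (i : ι) : Integrable (fun x : ι → E => (1 - ‖x i‖ ^ 2 / finrank ℝ E) ^ 2)
      (Measure.pi fun _ : ι => stdGaussian E) :=
    integrable_comp_eval (X := fun _ => E) (μ := fun _ => stdGaussian E)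
      integrable_norm_sq_deviation_stdGaussian
  have integral_eq : ∫ x, normDeviation x ∂(Measure.pi fun _ : ι => stdGaussian E) =
      Fintype.card ι * (Var[fun x => x ^ 2; gaussianReal 0 1] / finrank ℝ E) := by
    simp only [normDeviation]
    rw [integral_finsetSum _ fun i _ => integrable i, Finset.sum_congr rfl fun i _ =>
      (integral_comp_eval (X := fun _ => E) (μ := fun _ => stdGaussian E)
        integrable_norm_sq_deviation_stdGaussian.aestronglyMeasurable).trans
        integral_norm_sq_deviation_stdGaussian]
    simp
  refine (measureReal_lt_le_div_of_integral_le (integrable_finsetSum _ fun i _ => integrable i)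
    (fun x => Finset.sum_nonneg fun i _ => sq_nonneg _) (by positivity) integral_eq.le).trans_eq ?_
  field_simp

lemma ae_pi_ne_zero_stdGaussian :
    ∀ᵐ x ∂(Measure.pi fun _ : ι => stdGaussian E), ∀ i, x i ≠ 0 :=
  ae_all_iff.2 fun i =>
    (measurePreserving_eval (fun _ => stdGaussian E) i).quasiMeasurePreserving.ae
      ae_ne_zero_stdGaussian

lemma measureReal_compl_goodRows_le [DecidableEq ι] (θ f κ : ℝ) :
    (Measure.pi fun _ : ι => stdGaussian E).real (goodRows θ f κ)ᶜ ≤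
      (Measure.pi fun _ : ι => (stdGaussian E).map NormedSpace.normalize).real
          {v | ∃ i j, i ≠ j ∧ θ < inner ℝ (v i) (v j) ^ 2} +
        (Measure.pi fun _ : ι => (stdGaussian E).map NormedSpace.normalize).real
          {v | f ^ 2 < sqOffDiag (centeredSq v)} +
        (Measure.pi fun _ : ι => stdGaussian E).real
          {x | κ * Fintype.card ι < normDeviation x} := by
  let normalizeRows : (ι → E) → ι → E := fun x i => normalize (x i)
  let bad : Set (ι → E) := normalizeRows ⁻¹' {v | ∃ i j, i ≠ j ∧ θ < inner ℝ (v i) (v j) ^ 2} ∪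
    normalizeRows ⁻¹' {v | f ^ 2 < sqOffDiag (centeredSq v)} ∪
    {x | κ * Fintype.card ι < normDeviation x}
  have ae_subset : (goodRows θ f κ)ᶜ ≤ᵐ[Measure.pi fun _ : ι => stdGaussian E] bad := by
    filter_upwards [ae_pi_ne_zero_stdGaussian] with x ne_zero not_good
    by_contra not_bad
    replace not_bad : x ∉ bad := not_bad
    simp only [bad, normalizeRows, Set.mem_union, Set.mem_preimage, Set.mem_ofPred_eq, not_or,
      not_exists, not_and, not_lt] at not_bad
    exact not_good ⟨ne_zero, not_bad.1.1, not_bad.1.2, not_bad.2⟩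
  calc _ ≤ (Measure.pi fun _ : ι => stdGaussian E).real bad :=
        ENNReal.toReal_mono (measure_ne_top _ _) (measure_mono_ae ae_subset)
    _ ≤ _ := by
        refine (measureReal_union_le _ _).trans (add_le_add_left ?_ _)
        exact (measureReal_union_le _ _).trans
          (add_le_add (measureReal_preimage_normalize_le _) (measureReal_preimage_normalize_le _))

/-- The bound on the probability that `n` independent standard Gaussian vectors in dimension `d`
are not good rows, obtained from the `2p`-th moments of the cosines, the second moment of the
squared centered overlap matrix, and the variance of the squared norms. -/
noncomputable def goodRowsFailureBound (n d p : ℕ) (θ f κ : ℝ) : ℝ :=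
  n ^ 2 * ((∫ x, x ^ (2 * p) ∂(gaussianReal 0 1)) / (d * θ) ^ p) +
    n ^ 2 * (n ^ 2 * (2 / (d * (d + 2) : ℝ)) ^ 3 + n * (2 / (d * (d + 2) : ℝ)) ^ 2) / f ^ 2 +
    Var[fun x => x ^ 2; gaussianReal 0 1] / (d * κ)

theorem one_sub_goodRowsFailureBound_le [DecidableEq ι] [Nonempty ι] {p : ℕ} (hp : p ≠ 0)
    {θ f κ : ℝ} (hθ : 0 < θ) (hf : 0 < f) (hκ : 0 < κ) :
    1 - goodRowsFailureBound (Fintype.card ι) (finrank ℝ E) p θ f κ ≤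
      (Measure.pi fun _ : ι => stdGaussian E).real (goodRows θ f κ) := by
  have hν : IsUniformOnSphere ((stdGaussian E).map NormedSpace.normalize) :=
    isUniformOnSphere_map_normalize
  have : IsProbabilityMeasure ((stdGaussian E).map (normalize : E → E)) :=
    Measure.isProbabilityMeasure_map (by fun_prop)
  have compl_le := (measureReal_compl_goodRows_le (E := E) (ι := ι) θ f κ).trans
    (add_le_add (add_le_add (hν.measureReal_exists_lt_inner_sq_le hθ hp)
      (hν.measureReal_lt_sqOffDiag_le hf)) (measureReal_lt_normDeviation_le hκ))
  rw [probReal_compl_eq_one_sub (measurableSet_goodRows θ f κ)] at compl_le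
  exact sub_le_comm.1 compl_le

end GaussianRows

section HomogeneousSpace

open MeasureTheory

variable {G X Y : Type*} [Group G] [MeasurableSpace G] [MeasurableSpace X] [MeasurableSpace Y]
  [MulAction G X] [MulAction.IsPretransitive G X] {ν : Measure G} [ν.IsMulRightInvariant]

omit [MeasurableSpace X] in
lemma measure_smul_mem_eq_of_isPretransitive [MeasurableMul G] (B : Set X) (x y : X) :
    ν {g | g • x ∈ B} = ν {g | g • y ∈ B} := by
  obtain ⟨h, rfl⟩ := MulAction.exists_smul_eq G x y
  rw [← measure_preimage_mul_right ν h {g | g • x ∈ B}]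
  simp only [Set.preimage_ofPred_eq, mul_smul]

variable [MeasurableMul G] [MeasurableSMul₂ G X] {μ : Measure X} [IsProbabilityMeasure μ]
  [SMulInvariantMeasure G X μ]

lemma measure_smul_mem_eq [IsProbabilityMeasure ν] {B : Set X} (hB : MeasurableSet B) (x : X) :
    ν {g | g • x ∈ B} = μ B := by
  have measurable_incidence : MeasurableSet {z : G × X | z.1 • z.2 ∈ B} :=
    (measurable_fst.smul measurable_snd) hB
  have measure_fiber (g : G) : μ {y | g • y ∈ B} = μ B :=
    measure_preimage_smul_of_nullMeasurableSet hB.nullMeasurableSet g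
  calc ν {g | g • x ∈ B} = ∫⁻ y, ν {g | g • y ∈ B} ∂μ := by
        simp only [measure_smul_mem_eq_of_isPretransitive B _ x, lintegral_const, measure_univ,
          mul_one]
    _ = ∫⁻ g, μ {y | g • y ∈ B} ∂ν :=
        (Measure.prod_apply_symm measurable_incidence).symm.trans
          (Measure.prod_apply measurable_incidence)
    _ = μ B := by simp only [measure_fiber, lintegral_const, measure_univ, mul_one]

theorem measure_le_of_forall_exists_smul_mem (ν : Measure G) [IsProbabilityMeasure ν]
    [ν.IsMulRightInvariant] {γ : Measure Y} [IsProbabilityMeasure γ] {act : G → Y → Y}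
    (measurable_act : Measurable (Function.uncurry act))
    (hact : ∀ g, MeasurePreserving (act g) γ γ) {S : Set Y} (hS : MeasurableSet S) {B : Set X}
    (h : ∀ y, ∃ x : X, ∀ g, act g y ∈ S → g • x ∈ B) : γ S ≤ μ B := by
  have measurable_incidence : MeasurableSet {z : G × Y | act z.1 z.2 ∈ S} := measurable_act hS
  have measure_fiber_le (y : Y) : ν {g | act g y ∈ S} ≤ μ B := by
    obtain ⟨x, hx⟩ := h y
    calc ν {g | act g y ∈ S} ≤ ν {g | g • x ∈ toMeasurable μ B} :=
          measure_mono fun g hg => subset_toMeasurable μ B (hx g hg)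
      _ = μ B := by rw [measure_smul_mem_eq (μ := μ) (measurableSet_toMeasurable μ B),
          measure_toMeasurable]
  calc γ S = ∫⁻ g, γ {y | act g y ∈ S} ∂ν := by
        simp only [← Set.preimage_ofPred_eq, (hact _).measure_preimage hS.nullMeasurableSet,
          Set.ofPred_mem_eq, lintegral_const, measure_univ, mul_one]
    _ = ∫⁻ y, ν {g | act g y ∈ S} ∂γ :=
        (Measure.prod_apply measurable_incidence).symm.trans
          (Measure.prod_apply_symm measurable_incidence)
    _ ≤ ∫⁻ _, μ B ∂γ := lintegral_mono measure_fiber_le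
    _ = μ B := by rw [lintegral_const, measure_univ, mul_one]

end HomogeneousSpace

section OrthogonalGroup

open MeasureTheory

instance OrthGroup.instContinuousStarEnd (n : ℕ) :
    ContinuousStar (EuclideanSpace ℝ (Fin n) →L[ℝ] EuclideanSpace ℝ (Fin n)) :=
  ⟨ContinuousLinearMap.adjoint.continuous⟩

/-- The orthogonal group `O(n)`, as the unitary elements of the algebra of continuous endomorphisms
of `ℝⁿ`, from which it takes its topology. -/
abbrev OrthGroup (n : ℕ) : Type :=
  unitary (EuclideanSpace ℝ (Fin n) →L[ℝ] EuclideanSpace ℝ (Fin n))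

variable {n d : ℕ}

namespace OrthGroup

noncomputable instance instMeasurableSpace : MeasurableSpace (OrthGroup n) := borel _

instance instBorelSpace : BorelSpace (OrthGroup n) := ⟨rfl⟩

instance instCompactSpace : CompactSpace (OrthGroup n) := by
  refine isCompact_iff_compactSpace.1 ((isCompact_closedBall
    (0 : EuclideanSpace ℝ (Fin n) →L[ℝ] EuclideanSpace ℝ (Fin n)) 1).of_isClosed_subset
    isClosed_unitary fun u hu => mem_closedBall_zero_iff.2 ?_)
  refine ContinuousLinearMap.opNorm_le_bound _ zero_le_one fun x => ?_
  rw [one_mul]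
  exact (Unitary.norm_map ⟨u, hu⟩ x).le

/-- The isometry of `ℝⁿ` given by an element of the orthogonal group. -/
noncomputable abbrev iso (u : OrthGroup n) :
    EuclideanSpace ℝ (Fin n) ≃ₗᵢ[ℝ] EuclideanSpace ℝ (Fin n) :=
  Unitary.linearIsometryEquiv u

lemma measurable_iso_apply (y : EuclideanSpace ℝ (Fin n)) (i : Fin n) :
    Measurable fun u : OrthGroup n => u.iso y i := by
  have continuous_apply : Continuous fun u : OrthGroup n =>
      (u : EuclideanSpace ℝ (Fin n) →L[ℝ] EuclideanSpace ℝ (Fin n)) y := by fun_prop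
  exact ((EuclideanSpace.proj i).continuous.comp continuous_apply).measurable

lemma measurable_iso_symm_apply (y : EuclideanSpace ℝ (Fin n)) (i : Fin n) :
    Measurable fun u : OrthGroup n => u.iso.symm y i := by
  have iso_symm (u : OrthGroup n) : u.iso.symm = u⁻¹.iso := (map_inv _ u).symm
  simp only [iso_symm]
  exact (measurable_iso_apply y i).comp measurable_inv

variable (n) in
/-- A right-invariant Haar probability measure on the orthogonal group. -/
noncomputable def rightHaar : Measure (OrthGroup n) := (Measure.haarMeasure ⊤).inv

instance instIsProbabilityMeasureRightHaar : IsProbabilityMeasure (rightHaar n) := by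
  have : IsProbabilityMeasure
      (Measure.haarMeasure (⊤ : TopologicalSpace.PositiveCompacts (OrthGroup n))) :=
    ⟨Measure.haarMeasure_self⟩
  exact Measure.isProbabilityMeasure_map measurable_inv.aemeasurable

instance instIsMulRightInvariantRightHaar : (rightHaar n).IsMulRightInvariant :=
  inferInstanceAs (Measure.inv _).IsMulRightInvariant

end OrthGroup

namespace Gr

noncomputable instance instMulAction : MulAction (OrthGroup n) (Gr n d) where
  smul u V := rotate u.iso V
  one_smul V := Subtype.ext (Submodule.map_id V.1)
  mul_smul _ _ V := Subtype.ext (Submodule.map_comp _ _ V.1)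

lemma smul_def (u : OrthGroup n) (V : Gr n d) : u • V = rotate u.iso V := rfl

lemma exists_rotate_eq (V W : Gr n d) : ∃ U, rotate U V = W := by
  have finrank_eq : Module.finrank ℝ V.1 = Module.finrank ℝ W.1 := V.2.trans W.2.symm
  let e : V.1 ≃ₗᵢ[ℝ] W.1 :=
    (stdOrthonormalBasis ℝ V.1).equiv (stdOrthonormalBasis ℝ W.1) (finCongr finrank_eq)
  let L := W.1.subtypeₗᵢ.comp e.toLinearIsometry
  refine ⟨L.extend.toLinearIsometryEquiv rfl, Subtype.ext
    (Submodule.eq_of_le_of_finrank_eq ?_ ((rotate _ V).2.trans W.2.symm))⟩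
  rintro _ ⟨x, hx, rfl⟩
  have extend_apply : L.extend x = e ⟨x, hx⟩ := L.extend_apply ⟨x, hx⟩
  exact extend_apply ▸ (e ⟨x, hx⟩).2

instance instIsPretransitive : MulAction.IsPretransitive (OrthGroup n) (Gr n d) where
  exists_smul_eq V W := by
    obtain ⟨U, hU⟩ := exists_rotate_eq V W
    refine ⟨Unitary.linearIsometryEquiv.symm U, ?_⟩
    rw [smul_def, OrthGroup.iso, MulEquiv.apply_symm_apply, hU]

lemma projMatrix_rotate (U : EuclideanSpace ℝ (Fin n) ≃ₗᵢ[ℝ] EuclideanSpace ℝ (Fin n))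
    (V : Gr n d) (i j : Fin n) :
    projMatrix (rotate U V).1 i j = ∑ k, U (EuclideanSpace.single k 1) i *
      ∑ l, projMatrix V.1 k l * U.symm (EuclideanSpace.single j 1) l := by
  simp only [← starProjection_apply_eq_sum]
  calc projMatrix (rotate U V).1 i j
      = U (V.1.starProjection (U.symm (EuclideanSpace.single j 1))) i :=
        congrArg (· i) (Submodule.starProjection_map_apply U V.1 _)
    _ = _ := linearMap_apply_eq_sum_single U.toLinearMap _ i

lemma measurable_projMatrix (i j : Fin n) : Measurable fun V : Gr n d => projMatrix V.1 i j :=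
  (measurable_pi_apply j).comp ((measurable_pi_apply i).comp (comap_measurable _))

instance instMeasurableSMul₂ : MeasurableSMul₂ (OrthGroup n) (Gr n d) where
  measurable_smul := by
    refine measurable_comap_iff.2 (measurable_pi_iff.2 fun i => measurable_pi_iff.2 fun j => ?_)
    simp only [Function.comp_def, Function.uncurry_def, smul_def, projMatrix_rotate]
    exact Finset.measurable_fun_sum _ fun k _ =>
      ((OrthGroup.measurable_iso_apply _ i).comp measurable_fst).mul <|
        Finset.measurable_fun_sum _ fun l _ =>
          ((measurable_projMatrix k l).comp measurable_snd).mul <|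
            (OrthGroup.measurable_iso_symm_apply _ l).comp measurable_fst

end Gr

lemma IsUniformSubspaceLaw.smulInvariantMeasure {μ : Measure (Gr n d)}
    (hμ : IsUniformSubspaceLaw μ) : SMulInvariantMeasure (OrthGroup n) (Gr n d) μ :=
  ⟨fun u _ hs => (hμ.invariant u.iso).measure_preimage hs.nullMeasurableSet⟩

end OrthogonalGroup

section RotateRows

open MeasureTheory ProbabilityTheory

variable {n : ℕ} {E : Type*} [NormedAddCommGroup E] [InnerProductSpace ℝ E]

/-- The action of an orthogonal transformation of `ℝⁿ` on `n`-tuples of vectors: when the tuple is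
viewed as a matrix with `n` rows, it multiplies this matrix on the left. -/
noncomputable def rotateRows (U : EuclideanSpace ℝ (Fin n) ≃ₗᵢ[ℝ] EuclideanSpace ℝ (Fin n)) :
    (Fin n → E) →ₗ[ℝ] (Fin n → E) :=
  LinearMap.pi fun i => ∑ k, U (EuclideanSpace.single k 1) i • LinearMap.proj k

variable (U : EuclideanSpace ℝ (Fin n) ≃ₗᵢ[ℝ] EuclideanSpace ℝ (Fin n)) (x : Fin n → E)

lemma rotateRows_apply (i : Fin n) :
    rotateRows U x i = ∑ k, U (EuclideanSpace.single k 1) i • x k := by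
  simp [rotateRows]

lemma analysisMap_rotateRows (e : E) : analysisMap (rotateRows U x) e = U (analysisMap x e) := by
  ext i
  rw [analysisMap_apply, rotateRows_apply, sum_inner]
  exact (Finset.sum_congr rfl fun k _ => real_inner_smul_left _ _ _).trans
    (linearMap_apply_eq_sum_single (U : _ →ₗ[ℝ] _) (analysisMap x e) i).symm

variable [FiniteDimensional ℝ E]

lemma sum_norm_rotateRows_sq : ∑ i, ‖rotateRows U x i‖ ^ 2 = ∑ i, ‖x i‖ ^ 2 := by
  simp only [← sum_norm_analysisMap_sq (stdOrthonormalBasis ℝ E), analysisMap_rotateRows,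
    LinearIsometryEquiv.norm_map]

/-- `rotateRows` as an isometry for the Frobenius norm. -/
noncomputable def rotateRowsIsometry :
    PiLp 2 (fun _ : Fin n => E) ≃ₗᵢ[ℝ] PiLp 2 (fun _ : Fin n => E) :=
  LinearIsometry.toLinearIsometryEquiv
    { toLinearMap := (WithLp.linearEquiv 2 ℝ (Fin n → E)).symm.toLinearMap ∘ₗ rotateRows U ∘ₗ
        (WithLp.linearEquiv 2 ℝ (Fin n → E)).toLinearMap
      norm_map' := fun x => (sq_eq_sq₀ (norm_nonneg _) (norm_nonneg _)).1 <| by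
        rw [PiLp.norm_sq_eq_of_L2, PiLp.norm_sq_eq_of_L2]
        exact sum_norm_rotateRows_sq U x.ofLp }
    rfl

variable [MeasurableSpace E] [BorelSpace E]

variable (n E) in
lemma measurePreserving_toLp_pi_stdGaussian :
    MeasurePreserving (WithLp.toLp 2) (Measure.pi fun _ : Fin n => stdGaussian E)
      (stdGaussian (PiLp 2 fun _ : Fin n => E)) := by
  refine ⟨WithLp.measurable_toLp 2 _, Measure.ext_of_charFun (funext fun t => ?_)⟩
  simp_rw [charFun_stdGaussian, charFun_pi, charFun_stdGaussian, ← Complex.exp_sum]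
  rw [← Complex.ofReal_pow, PiLp.norm_sq_eq_of_L2]
  push_cast
  rw [← Finset.sum_div, Finset.sum_neg_distrib]

lemma measurePreserving_rotateRows :
    MeasurePreserving (rotateRows U) (Measure.pi fun _ : Fin n => stdGaussian E)
      (Measure.pi fun _ => stdGaussian E) := by
  have toLp_mp := measurePreserving_toLp_pi_stdGaussian n E
  have ofLp_mp : MeasurePreserving WithLp.ofLp (stdGaussian (PiLp 2 fun _ : Fin n => E))
      (Measure.pi fun _ => stdGaussian E) :=
    toLp_mp.symm (MeasurableEquiv.toLp 2 (Fin n → E))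
  have isometry_mp : MeasurePreserving (rotateRowsIsometry U)
      (stdGaussian (PiLp 2 fun _ : Fin n => E)) (stdGaussian _) :=
    ⟨(rotateRowsIsometry U).continuous.measurable, stdGaussian_map _⟩
  exact ofLp_mp.comp (isometry_mp.comp toLp_mp)

lemma measurable_uncurry_rotateRows :
    Measurable (Function.uncurry fun (u : OrthGroup n) (x : Fin n → E) =>
      rotateRows u.iso x) := by
  refine measurable_pi_iff.2 fun i => ?_
  simp only [Function.uncurry_def, rotateRows_apply]
  exact Finset.measurable_fun_sum _ fun k _ =>
    ((OrthGroup.measurable_iso_apply _ i).comp measurable_fst).smul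
      ((measurable_pi_apply k).comp measurable_snd)

end RotateRows

lemma exists_submodule_ge_finrank_eq {K E : Type*} [DivisionRing K] [AddCommGroup E] [Module K E]
    [FiniteDimensional K E] {d : ℕ} (hd : d ≤ Module.finrank K E) (U : Submodule K E)
    (hU : Module.finrank K U ≤ d) : ∃ W : Submodule K E, U ≤ W ∧ Module.finrank K W = d := by
  induction d, hU using Nat.le_induction with
  | base => exact ⟨U, le_rfl, rfl⟩
  | succ d _ ih =>
    obtain ⟨W, hUW, rfl⟩ := ih (by omega)
    obtain ⟨v, hv⟩ : ∃ v, v ∉ W := by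
      by_contra! mem
      rw [Submodule.eq_top_iff'.2 mem, finrank_top] at hd
      omega
    exact ⟨W ⊔ K ∙ v, hUW.trans le_sup_left, Submodule.finrank_sup_span_singleton hv⟩

section Transfer

open MeasureTheory ProbabilityTheory

variable {n d : ℕ} {E : Type*} [NormedAddCommGroup E] [InnerProductSpace ℝ E]
  [FiniteDimensional ℝ E] [MeasurableSpace E] [BorelSpace E]

theorem measureReal_pi_stdGaussian_le_of_range_le {μ : Measure (Gr n d)}
    (hμ : IsUniformSubspaceLaw μ) (hE : Module.finrank ℝ E ≤ d) {S : Set (Fin n → E)}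
    (hS : MeasurableSet S) {A : Set (Gr n d)}
    (hA : ∀ x ∈ S, ∀ V : Gr n d, LinearMap.range (analysisMap x) ≤ V.1 → V ∈ A) :
    (Measure.pi fun _ : Fin n => stdGaussian E).real S ≤ μ.real A := by
  have := hμ.isProbabilityMeasure
  have := hμ.smulInvariantMeasure
  obtain ⟨V₀⟩ : Nonempty (Gr n d) := nonempty_of_isProbabilityMeasure μ
  refine ENNReal.toReal_mono (measure_ne_top μ A) (measure_le_of_forall_exists_smul_mem
    (OrthGroup.rightHaar n) measurable_uncurry_rotateRows
    (fun u => measurePreserving_rotateRows u.iso) hS fun x => ?_)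
  obtain ⟨W, range_le, finrank_W⟩ := exists_submodule_ge_finrank_eq
    (V₀.2 ▸ Submodule.finrank_le V₀.1) (LinearMap.range (analysisMap x))
    ((LinearMap.finrank_range_le _).trans hE)
  refine ⟨⟨W, finrank_W⟩, fun u hu => hA _ hu _ ?_⟩
  rintro _ ⟨e, rfl⟩
  rw [analysisMap_rotateRows]
  exact ⟨_, range_le ⟨e, rfl⟩, rfl⟩

end Transfer

section Asymptotics

open MeasureTheory ProbabilityTheory Filter Topology

variable {n d p : ℕ} {s w : ℝ}

/-- The `d`-dimensional subspaces `V` for which some degree-4 SoS SDP solution has value at least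
`c` for `Π_V`. -/
def highValueSubspaces (n d : ℕ) (c : ℝ) : Set (Gr n d) :=
  {V | ∃ M : Matrix (SmallSet n) (SmallSet n) ℝ, IsSoS4 M ∧
    c ≤ (1 / (n : ℝ)) * sosValue (projMatrix V.1) M}

theorem one_sub_goodRowsFailureBound_le_measureReal {θ f η τ κ : ℝ} [NeZero n] [NeZero d]
    (hpar : AdmissibleParameters n d θ f η τ) (hp : p ≠ 0) (hf : 0 < f) (hκ : 0 < κ)
    {μ : Measure (Gr n d)} (hμ : IsUniformSubspaceLaw μ) :
    1 - goodRowsFailureBound n d p θ f κ ≤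
      μ.real (highValueSubspaces n d ((1 + τ)⁻¹ * (1 - κ))) := by
  have finrank_eq : Module.finrank ℝ (EuclideanSpace ℝ (Fin d)) = d := finrank_euclideanSpace_fin
  have hθ : 0 < θ := hpar.inv_dim_le.trans_lt' (by have := NeZero.pos d; positivity)
  calc 1 - goodRowsFailureBound n d p θ f κ
      ≤ (Measure.pi fun _ : Fin n => stdGaussian (EuclideanSpace ℝ (Fin d))).real
          (goodRows θ f κ) := by
        simpa only [finrank_eq, Fintype.card_fin] using one_sub_goodRowsFailureBound_le
          (E := EuclideanSpace ℝ (Fin d)) (ι := Fin n) hp hθ hf hκ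
    _ ≤ _ := measureReal_pi_stdGaussian_le_of_range_le hμ finrank_eq.le
        (measurableSet_goodRows θ f κ) fun x hx V hV =>
          exists_isSoS4_of_mem_goodRows (finrank_eq.symm ▸ hpar) hx hV

/-- Two scales of which all parameters of the construction are monomials. The model is
`s = n ^ (-γ)` and `w = n ^ (-1/8)`, where `n ^ (7/8 + 3 * γ) ≤ d` and `17/8 ≤ γ * p`. -/
structure IsScalePair (n d p : ℕ) (s w : ℝ) : Prop where
  s_pos : 0 < s
  w_pos : 0 < w
  s_le : 18 * s ≤ 1
  w_le : 18 * w ≤ 1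
  natCast_mul_pow : n * w ^ 8 = 1
  one_le_mul_dim : 1 ≤ s ^ 3 * w ^ 7 * d
  pow_le : s ^ p ≤ w ^ 17

/-- The loss `ε` in the value of the relaxation at the scales `s` and `w`. -/
noncomputable def valueLoss (s w : ℝ) : ℝ := 1 - (1 + s)⁻¹ * (1 - s ^ 2 * w ^ 7)

/-- The bound `δ` on the probability of failure at the scales `s` and `w`; the exponent `p` is that
of the moment used to control the overlaps. -/
noncomputable def failureBound (p : ℕ) (s w : ℝ) : ℝ :=
  (∫ x, x ^ (2 * p) ∂gaussianReal 0 1) * w + (8 * s ^ 8 * w ^ 6 + 4 * s ^ 2) +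
    Var[fun x => x ^ 2; gaussianReal 0 1] * s

namespace IsScalePair

lemma natCast_eq (h : IsScalePair n d p s w) : (n : ℝ) = (w ^ 8)⁻¹ :=
  eq_inv_of_mul_eq_one_left h.natCast_mul_pow

lemma natCast_ne_zero (h : IsScalePair n d p s w) : n ≠ 0 := by
  rintro rfl
  simpa using h.natCast_mul_pow

lemma dim_ne_zero (h : IsScalePair n d p s w) : d ≠ 0 := by
  rintro rfl
  simpa using h.one_le_mul_dim.trans_lt' zero_lt_one

lemma inv_dim_le (h : IsScalePair n d p s w) : (d : ℝ)⁻¹ ≤ s ^ 3 * w ^ 7 := by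
  have dim_pos : (0 : ℝ) < d := by exact_mod_cast Nat.pos_of_ne_zero h.dim_ne_zero
  rw [inv_le_iff_one_le_mul₀ dim_pos]
  exact h.one_le_mul_dim

lemma exponent_ne_zero (h : IsScalePair n d p s w) : p ≠ 0 := by
  rintro rfl
  have w_lt_one : w < 1 := by linarith [h.w_le]
  exact (pow_lt_one₀ h.w_pos.le w_lt_one (n := 17) (by norm_num)).not_ge (by simpa using h.pow_le)

lemma admissibleParameters (h : IsScalePair n d p s w) :
    AdmissibleParameters n d (s ^ 2 * w ^ 7) (s ^ 5 * w ^ 2) (s ^ 2 * w) s := by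
  obtain ⟨hs, hw, hs', hw', -, -, -⟩ := id h
  have s_le_one : s ≤ 1 := by linarith
  have w_le_one : w ≤ 1 := by linarith
  have s_sq_le : s ^ 2 ≤ s := pow_le_of_le_one hs.le s_le_one two_ne_zero
  have w_pow_le {k : ℕ} (hk : k ≠ 0) : w ^ k ≤ w := pow_le_of_le_one hw.le w_le_one hk
  refine ⟨by positivity, by positivity, ?_, ?_, ?_, ?_, ?_, ?_⟩
  · nlinarith
  · nlinarith
  · calc (d : ℝ)⁻¹ ≤ s ^ 3 * w ^ 7 := h.inv_dim_le
      _ ≤ s ^ 2 * w ^ 7 := by gcongr ?_ * _; nlinarith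
  · calc 2 * (s ^ 2 * w ^ 7) + 2 * n * (s ^ 2 * w ^ 7) ^ 2 + 4 * (s ^ 2 * w) * n * (s ^ 2 * w ^ 7)
        = s ^ 2 * (2 * w ^ 7 + 2 * s ^ 2 * w ^ 6 + 4 * s ^ 2) := by
          rw [h.natCast_eq]; field_simp
      _ ≤ s ^ 2 * (2 * w + 2 * s * 1 + 4 * s) := by
          gcongr
          · exact w_pow_le (by norm_num)
          · exact pow_le_one₀ hw.le w_le_one
      _ ≤ s ^ 2 := mul_le_of_le_one_right (by positivity) (by linarith)
  · calc (1 + 3 / (s ^ 2 * w)) * (n / (d : ℝ) ^ 2)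
        = (1 + 3 / (s ^ 2 * w)) * (n * (d : ℝ)⁻¹ ^ 2) := by rw [inv_pow, div_eq_mul_inv (n : ℝ)]
      _ ≤ (1 + 3 / (s ^ 2 * w)) * (n * (s ^ 3 * w ^ 7) ^ 2) := by gcongr; exact h.inv_dim_le
      _ = s ^ 2 * w * (s ^ 4 * w ^ 5 + 3 * s ^ 2 * w ^ 4) := by rw [h.natCast_eq]; field_simp
      _ ≤ s ^ 2 * w * (1 * w + 3 * s * 1) := by
          gcongr
          · exact pow_le_one₀ hs.le s_le_one
          · exact w_pow_le (by norm_num)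
          · exact pow_le_one₀ hw.le w_le_one
      _ ≤ s ^ 2 * w / 2 := by
          rw [div_eq_mul_inv (s ^ 2 * w)]
          gcongr
          linarith
  · calc n * (s ^ 2 * w ^ 7) ^ 2 + s ^ 5 * w ^ 2 = (s ^ 2 * w) ^ 2 * (w ^ 4 + s) := by
          rw [h.natCast_eq]; field_simp
      _ ≤ (s ^ 2 * w) ^ 2 * (w + s) := by gcongr; exact w_pow_le (by norm_num)
      _ ≤ (s ^ 2 * w) ^ 2 * (1 / 9) := by gcongr; linarith
      _ = (s ^ 2 * w / 3) ^ 2 := by ring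

lemma goodRowsFailureBound_le (h : IsScalePair n d p s w) :
    goodRowsFailureBound n d p (s ^ 2 * w ^ 7) (s ^ 5 * w ^ 2) (s ^ 2 * w ^ 7) ≤
      failureBound p s w := by
  obtain ⟨hs, hw, -, -, -, -, pow_le⟩ := id h
  have moment_nonneg : 0 ≤ ∫ x, x ^ (2 * p) ∂gaussianReal 0 1 :=
    integral_nonneg fun x => (even_two_mul p).pow_nonneg x
  have inv_le : (d * (s ^ 2 * w ^ 7))⁻¹ ≤ s := by
    calc (d * (s ^ 2 * w ^ 7))⁻¹ = (d : ℝ)⁻¹ / (s ^ 2 * w ^ 7) := by rw [mul_inv, div_eq_mul_inv]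
      _ ≤ s ^ 3 * w ^ 7 / (s ^ 2 * w ^ 7) := by gcongr; exact h.inv_dim_le
      _ = s := by field_simp
  have variance_le : 2 / (d * (d + 2) : ℝ) ≤ 2 * (s ^ 3 * w ^ 7) ^ 2 := by
    have dim_pos : (0 : ℝ) < d := by exact_mod_cast Nat.pos_of_ne_zero h.dim_ne_zero
    calc 2 / (d * (d + 2) : ℝ) ≤ 2 / (d * d) := by gcongr; linarith
      _ = 2 * (d : ℝ)⁻¹ ^ 2 := by field_simp
      _ ≤ 2 * (s ^ 3 * w ^ 7) ^ 2 := by gcongr; exact h.inv_dim_le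
  unfold goodRowsFailureBound failureBound
  gcongr ?_ + ?_ + ?_
  · calc (n : ℝ) ^ 2 * ((∫ x, x ^ (2 * p) ∂gaussianReal 0 1) / (d * (s ^ 2 * w ^ 7)) ^ p)
        = (n : ℝ) ^ 2 * ((∫ x, x ^ (2 * p) ∂gaussianReal 0 1) *
            (d * (s ^ 2 * w ^ 7))⁻¹ ^ p) := by rw [inv_pow, div_eq_mul_inv]
      _ ≤ (n : ℝ) ^ 2 * ((∫ x, x ^ (2 * p) ∂gaussianReal 0 1) * w ^ 17) := by
          gcongr
          exact (pow_le_pow_left₀ (by positivity) inv_le p).trans pow_le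
      _ = (∫ x, x ^ (2 * p) ∂gaussianReal 0 1) * w := by rw [h.natCast_eq]; field_simp
  · calc (n : ℝ) ^ 2 * (n ^ 2 * (2 / (d * (d + 2))) ^ 3 + n * (2 / (d * (d + 2))) ^ 2) /
          (s ^ 5 * w ^ 2) ^ 2
        ≤ (n : ℝ) ^ 2 * (n ^ 2 * (2 * (s ^ 3 * w ^ 7) ^ 2) ^ 3 +
            n * (2 * (s ^ 3 * w ^ 7) ^ 2) ^ 2) / (s ^ 5 * w ^ 2) ^ 2 := by gcongr
      _ = 8 * s ^ 8 * w ^ 6 + 4 * s ^ 2 := by rw [h.natCast_eq]; field_simp; ring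
  · rw [div_eq_mul_inv]
    gcongr
    exact variance_nonneg _ _

theorem one_sub_failureBound_le (h : IsScalePair n d p s w) {μ : Measure (Gr n d)}
    (hμ : IsUniformSubspaceLaw μ) :
    1 - failureBound p s w ≤ μ.real (highValueSubspaces n d (1 - valueLoss s w)) := by
  have : NeZero n := ⟨h.natCast_ne_zero⟩
  have : NeZero d := ⟨h.dim_ne_zero⟩
  have := h.s_pos
  have := h.w_pos
  rw [valueLoss, sub_sub_cancel]
  exact (sub_le_sub_left h.goodRowsFailureBound_le 1).trans
    (one_sub_goodRowsFailureBound_le_measureReal h.admissibleParameters h.exponent_ne_zero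
      (by positivity) (by positivity) hμ)

end IsScalePair

lemma tendsto_natCast_rpow_neg {a : ℝ} (ha : 0 < a) :
    Tendsto (fun n : ℕ => (n : ℝ) ^ (-a)) atTop (𝓝 0) :=
  (tendsto_rpow_neg_atTop ha).comp tendsto_natCast_atTop_atTop

lemma eventually_isScalePair {γ : ℝ} (hγ : 0 < γ) (hp : 17 / 8 ≤ p * γ) :
    ∀ᶠ n : ℕ in atTop, ∀ d : ℕ, (n : ℝ) ^ (7 / 8 + 3 * γ) ≤ d →
      IsScalePair n d p ((n : ℝ) ^ (-γ)) ((n : ℝ) ^ (-(1 / 8) : ℝ)) := by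
  have eventually_small {a : ℝ} (ha : 0 < a) : ∀ᶠ n : ℕ in atTop, 18 * (n : ℝ) ^ (-a) ≤ 1 := by
    have := (tendsto_natCast_rpow_neg ha).const_mul 18
    rw [mul_zero] at this
    exact this.eventually_le_const zero_lt_one
  filter_upwards [eventually_small hγ, eventually_small (a := 1 / 8) (by norm_num),
    eventually_ge_atTop 1] with n hs hw hn d hd
  have one_le : (1 : ℝ) ≤ n := by exact_mod_cast hn
  have n_pos : (0 : ℝ) < n := by linarith
  refine ⟨by positivity, by positivity, hs, hw, ?_, ?_, ?_⟩
  · calc (n : ℝ) * ((n : ℝ) ^ (-(1 / 8) : ℝ)) ^ 8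
        = (n : ℝ) ^ (1 + -(1 / 8) * (8 : ℕ) : ℝ) := by
          rw [Real.rpow_add n_pos, Real.rpow_one, Real.rpow_mul_natCast n_pos.le]
      _ = 1 := by norm_num
  · calc (1 : ℝ) = (n : ℝ) ^ (-γ * (3 : ℕ) + -(1 / 8) * (7 : ℕ) + (7 / 8 + 3 * γ)) := by
          push_cast; ring_nf; exact (Real.rpow_zero _).symm
      _ = ((n : ℝ) ^ (-γ)) ^ 3 * ((n : ℝ) ^ (-(1 / 8) : ℝ)) ^ 7 * (n : ℝ) ^ (7 / 8 + 3 * γ) := by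
          simp only [Real.rpow_add n_pos _ _, Real.rpow_mul_natCast n_pos.le]
      _ ≤ _ := by gcongr
  · rw [← Real.rpow_mul_natCast n_pos.le, ← Real.rpow_mul_natCast n_pos.le]
    refine Real.rpow_le_rpow_of_exponent_le one_le ?_
    push_cast
    linarith

lemma tendsto_valueLoss {β : Type*} {l : Filter β} {s w : β → ℝ} (hs : Tendsto s l (𝓝 0))
    (hw : Tendsto w l (𝓝 0)) : Tendsto (fun b => valueLoss (s b) (w b)) l (𝓝 0) := by
  simpa [valueLoss] using (tendsto_const_nhds (x := (1 : ℝ))).sub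
    (((hs.const_add 1).inv₀ (by norm_num)).mul (((hs.pow 2).mul (hw.pow 7)).const_sub 1))

lemma tendsto_failureBound {β : Type*} {l : Filter β} {s w : β → ℝ} (p : ℕ)
    (hs : Tendsto s l (𝓝 0)) (hw : Tendsto w l (𝓝 0)) :
    Tendsto (fun b => failureBound p (s b) (w b)) l (𝓝 0) := by
  simpa [failureBound] using ((hw.const_mul _).add
    ((((hs.pow 8).const_mul 8).mul (hw.pow 6)).add ((hs.pow 2).const_mul 4))).add (hs.const_mul _)

lemma exists_tendsto_forall_of_eventually {α β : Type*} [TopologicalSpace β] {l : Filter α}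
    {P : α → β → Prop} {u : α → β} {b : β} (hu : Tendsto u l (𝓝 b)) (h : ∀ᶠ a in l, P a (u a))
    (h' : ∀ a, ∃ c, P a c) : ∃ v : α → β, Tendsto v l (𝓝 b) ∧ ∀ a, P a (v a) := by
  classical
  choose c hc using h'
  refine ⟨fun a => if P a (u a) then u a else c a, hu.congr' ?_, fun a => ?_⟩
  · filter_upwards [h] with a ha using (if_pos ha).symm
  · by_cases ha : P a (u a)
    · simpa only [if_pos ha] using ha
    · simpa only [if_neg ha] using hc a

end Asymptotics

theorem theorem1p6_general {α : ℝ} (hα : 7 / 8 < α) :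
    ∃ ε δ : ℕ → ℝ,
      Filter.Tendsto ε Filter.atTop (nhds 0) ∧ Filter.Tendsto δ Filter.atTop (nhds 0) ∧
      ∀ (n d : ℕ), (n : ℝ) ^ α ≤ (d : ℝ) →
        ∀ μ : MeasureTheory.Measure (Gr n d), IsUniformSubspaceLaw μ →
          1 - δ n ≤ μ.real {V : Gr n d | ∃ M : Matrix (SmallSet n) (SmallSet n) ℝ,
            IsSoS4 M ∧ 1 - ε n ≤ (1 / (n : ℝ)) * sosValue (projMatrix V.1) M} := by
  obtain ⟨γ, hγ, rfl⟩ : ∃ γ, 0 < γ ∧ α = 7 / 8 + 3 * γ := ⟨(α - 7 / 8) / 3, by linarith, by ring⟩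
  obtain ⟨p, hp⟩ : ∃ p : ℕ, 17 / 8 ≤ p * γ := by
    simpa only [nsmul_eq_mul] using Archimedean.arch (17 / 8) hγ
  have tendsto_s := tendsto_natCast_rpow_neg hγ
  have tendsto_w := tendsto_natCast_rpow_neg (a := 1 / 8) (by norm_num)
  obtain ⟨δ, tendsto_δ, one_sub_le⟩ := exists_tendsto_forall_of_eventually
    (P := fun (n : ℕ) δ => ∀ d : ℕ, (n : ℝ) ^ (7 / 8 + 3 * γ) ≤ d →
      ∀ μ : MeasureTheory.Measure (Gr n d), IsUniformSubspaceLaw μ → 1 - δ ≤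
        μ.real (highValueSubspaces n d (1 - valueLoss (n ^ (-γ)) (n ^ (-(1 / 8) : ℝ)))))
    (tendsto_failureBound p tendsto_s tendsto_w)
    ((eventually_isScalePair hγ hp).mono fun n h d hd μ hμ => (h d hd).one_sub_failureBound_le hμ)
    fun n => ⟨1, fun d _ μ _ => (sub_self (1 : ℝ)).trans_le MeasureTheory.measureReal_nonneg⟩
  exact ⟨_, δ, tendsto_valueLoss tendsto_s tendsto_w, tendsto_δ, one_sub_le⟩

theorem theorem1p6 :
    ∃ ε δ : ℕ → ℝ,
      Filter.Tendsto ε Filter.atTop (nhds 0) ∧ Filter.Tendsto δ Filter.atTop (nhds 0) ∧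
      ∀ (n d : ℕ), (n : ℝ) ^ (0.99 : ℝ) ≤ (d : ℝ) →
        ∀ μ : MeasureTheory.Measure (Gr n d), IsUniformSubspaceLaw μ →
          1 - δ n ≤ μ.real {V : Gr n d | ∃ M : Matrix (SmallSet n) (SmallSet n) ℝ,
            IsSoS4 M ∧ 1 - ε n ≤ (1 / (n : ℝ)) * sosValue (projMatrix V.1) M} :=
  theorem1p6_general (by norm_num)
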